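/- Let $p$ be an odd prime. Let $\widehat{\mathcal U}$ be the free noncommutative unital $\mathbb F_p$-algebra on generators $e_i$, $i\ge 0$, and put $e_i=0$ for negative integers $i$. Let $\widetilde{\mathcal U}$ be the quotient of $\widehat{\mathcal U}$ by the two-sided ideal generated by the $e_i$ with $i$ odd, and let $\mathcal U$ be the quotient of $\widehat{\mathcal U}$ by the two-sided ideal generated by the $e_i$ with $(p-1)\nmid i$; in $\mathcal U$ write $d_i=e_{i(p-1)}$. The Adem relations are $$e_ie_j=\sum_{k\in\mathbb Z}(-1)^{\frac{pk-i}{p-1}}\binom{k-j-1}{\frac{pk-i}{p-1}-j}\,e_{i+pj-pk}\,e_k\qquad(i,j\ge 0),$$ where a term is present only if $\frac{pk-i}{p-1}$ is an integer, and $\binom{a}{b}=\frac{a(a-1)\cdots(a-b+1)}{b!}$ for $a\in\mathbb Z$ and $b\ge 0$, $\binom ab=0$ for $b<0$. Let $\widehat{\mathcal K}$ be the quotient of $\widehat{\mathcal U}$ by all Adem relations, $\widetilde{\mathcal K}$ the quotient of $\widetilde{\mathcal U}$ by the Adem relations with $i,j$ even, and $\mathcal K$ the quotient of $\mathcal U$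 by the Adem relations with $i,j$ divisible by $p-1$. The length $n$ component of $\widehat{\mathcal K}$ is the span of all monomials $e_{i_1}\cdots e_{i_n}$. (a) An $\mathbb F_p$-vector space basis of $\widetilde{\mathcal K}$ is given by the monomials $e_{i_1}\cdots e_{i_n}$, $n\ge 0$, for which all $i_k$ are even, $0\le i_1\le\cdots\le i_n$, and $i_k\equiv i_{k-1}\pmod{p-1}$ for $2\le k\le n$. The monomials of this kind with $n>1$ form a basis of the part of $\widehat{\mathcal K}$ of length greater than one (the sum of its components of length $n>1$), and for each $n>1$ those of length $n$ form a basis of the length $n$ component. (b) An $\mathbb F_p$-vector space basis of $\mathcal K$ is given by the monomials $d_{i_1}\cdots d_{i_n}$, $n\ge 0$, with $0\le i_1\le\cdots\le i_n$. -/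

import Mathlib

/-!
Algebras over `ZMod p` on generators `e_i`, `i ≥ 0`, modulo the Adem relations
`e_i e_j ∼ ∑_k (-1)^((pk-i)/(p-1)) * binom(k-j-1, (pk-i)/(p-1) - j) * e_{i+pj-pk} e_k`.
-/

noncomputable section

namespace KudoArakiMay

/-- The binomial coefficient `binom(a, b)` with an arbitrary integer numerator `a`:
`a (a-1) ⋯ (a-b+1) / b!` for `b ≥ 0`, and `0` for `b < 0`. -/
def intBinom (a b : ℤ) : ℤ :=
  if 0 ≤ b then Ring.choose a b.toNat else 0

section Adem

variable (p : ℕ) {A : Type*} [Ring A] [Algebra (ZMod p) A]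

/-- The convention `e_i = 0` for negative integers `i`. -/
def zeroExt (e : ℕ → A) (i : ℤ) : A :=
  if 0 ≤ i then e i.toNat else 0

/-- The term with index `k` on the right side of the Adem relation for `e_i e_j`; it is present
only if `(pk-i)/(p-1)` is an integer. -/
def ademTerm (e : ℕ → A) (i j : ℕ) (k : ℤ) : A :=
  if ((p : ℤ) - 1) ∣ ((p : ℤ) * k - i) then
    (((((-1 : ℤˣ) ^ (((p : ℤ) * k - i) / ((p : ℤ) - 1)) : ℤˣ) : ℤ) *
        intBinom (k - j - 1) (((p : ℤ) * k - i) / ((p : ℤ) - 1) - j) : ℤ) : ZMod p) •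
      (zeroExt e ((i : ℤ) + p * j - p * k) * zeroExt e k)
  else 0

/-- The right side `θ(e_i e_j)` of the Adem relation, for `i, j ≥ 0`. The sum is over all integers
`k`; only those with `0 ≤ k` and `pk ≤ i + pj` contribute (see `ademRHS_eq_finsum`). -/
def ademRHS (e : ℕ → A) (i j : ℕ) : A :=
  ∑ k ∈ Finset.range (i + p * j + 1), ademTerm p e i j (k : ℤ)

theorem ademTerm_eq_zero (hp : 0 < p) (e : ℕ → A) (i j : ℕ) (k : ℤ)
    (hk : k < 0 ∨ ((i + p * j : ℕ) : ℤ) < k) : ademTerm p e i j k = 0 := by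
  unfold ademTerm
  split_ifs with h
  · rcases hk with hk | hk
    · simp [zeroExt, not_le.mpr hk]
    · have h1 : zeroExt e ((i : ℤ) + p * j - p * k) = 0 := by
        refine if_neg ?_
        push_cast at hk
        have hp' : (1 : ℤ) ≤ p := by exact_mod_cast hp
        have : (0 : ℤ) ≤ (i : ℤ) + p * j := by positivity
        nlinarith
      rw [h1, zero_mul, smul_zero]
  · rfl

/-- The sum in `ademRHS` is the sum over all integers `k`. -/
theorem ademRHS_eq_finsum (hp : 0 < p) (e : ℕ → A) (i j : ℕ) :
    ademRHS p e i j = ∑ᶠ k : ℤ, ademTerm p e i j k := by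
  classical
  rw [finsum_eq_sum_of_support_subset (s := (Finset.range (i + p * j + 1)).map Nat.castEmbedding)]
  · simp [ademRHS]
  · intro k hk
    have h : ¬ (k < 0 ∨ ((i + p * j : ℕ) : ℤ) < k) :=
      fun h => hk (ademTerm_eq_zero p hp e i j k h)
    push Not at h
    simp only [Finset.coe_map, Set.mem_image, Finset.coe_range, Set.mem_Iio]
    exact ⟨k.toNat, by omega, by simp [h.1]⟩

/-- The Adem relations between the `e_i` with `i ∈ S`: `e_i e_j ∼ θ(e_i e_j)` for `i, j ∈ S`. -/
def AdemRel (e : ℕ → A) (S : Set ℕ) (x y : A) : Prop :=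
  ∃ i ∈ S, ∃ j ∈ S, x = e i * e j ∧ y = ademRHS p e i j

/-- The monomial `e_{i_1} ⋯ e_{i_n}` of a list of indices; the empty list gives `1`. -/
def monomial {B : Type*} [Monoid B] (e : ℕ → B) (w : List ℕ) : B :=
  (w.map e).prod

/-- The length `n` component: the span of all monomials of length `n` in the generators. -/
def lengthPart (e : ℕ → A) (n : ℕ) : Submodule (ZMod p) A :=
  Submodule.span (ZMod p) {x | ∃ w : List ℕ, w.length = n ∧ x = monomial e w}

/-- The sum of the components of length greater than one. -/
def lengthGTOne (e : ℕ → A) : Submodule (ZMod p) A :=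
  ⨆ n : {n : ℕ // 1 < n}, lengthPart p e n

end Adem

section Algebras

variable (p : ℕ)

/-- `Û`: the free noncommutative algebra on `e_i`, `i ≥ 0`. -/
abbrev UHat : Type := FreeAlgebra (ZMod p) ℕ

/-- The generators of `Û`. -/
def eUHat (i : ℕ) : UHat p := FreeAlgebra.ι (ZMod p) i

/-- The relations `e_i ∼ 0` for those `i` outside `S`. -/
def KillRel (S : Set ℕ) (x y : UHat p) : Prop :=
  ∃ i, i ∉ S ∧ x = eUHat p i ∧ y = 0

/-- `Ũ`: the quotient of `Û` by the two-sided ideal generated by the `e_i` with `i` odd. -/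
abbrev UTilde : Type := RingQuot (KillRel p {i | Even i})

/-- The images of the `e_i` in `Ũ`. -/
def eUTilde (i : ℕ) : UTilde p :=
  RingQuot.mkAlgHom (ZMod p) (KillRel p {i | Even i}) (eUHat p i)

/-- `U`: the quotient of `Û` by the two-sided ideal generated by the `e_i` with `i` not divisible
by `p - 1`. -/
abbrev UEven : Type := RingQuot (KillRel p {i | (p - 1) ∣ i})

/-- The images of the `e_i` in `U`. -/
def eUEven (i : ℕ) : UEven p :=
  RingQuot.mkAlgHom (ZMod p) (KillRel p {i | (p - 1) ∣ i}) (eUHat p i)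

/-- `K̂`: the quotient of `Û` by its Adem relations. -/
abbrev KHat : Type := RingQuot (AdemRel p (eUHat p) Set.univ)

/-- The images of the `e_i` in `K̂`. -/
def eKHat (i : ℕ) : KHat p :=
  RingQuot.mkAlgHom (ZMod p) (AdemRel p (eUHat p) Set.univ) (eUHat p i)

/-- `K̃`: the quotient of `Ũ` by its Adem relations, those between the `e_i` with `i` even. -/
abbrev KTilde : Type := RingQuot (AdemRel p (eUTilde p) {i | Even i})

/-- The images of the `e_i` in `K̃`. -/
def eKTilde (i : ℕ) : KTilde p :=
  RingQuot.mkAlgHom (ZMod p) (AdemRel p (eUTilde p) {i | Even i}) (eUTilde p i)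

/-- `K`: the quotient of `U` by its Adem relations, those between the `e_i` with `i` divisible by
`p - 1`. -/
abbrev KEven : Type := RingQuot (AdemRel p (eUEven p) {i | (p - 1) ∣ i})

/-- The generators `d_i = e_{i(p-1)}` of `K`. -/
def dKEven (i : ℕ) : KEven p :=
  RingQuot.mkAlgHom (ZMod p) (AdemRel p (eUEven p) {i | (p - 1) ∣ i}) (eUEven p (i * (p - 1)))

/-- Admissibility: `i_1 ≤ ⋯ ≤ i_n`. -/
def Admissible (w : List ℕ) : Prop := w.IsChain (· ≤ ·)

/-- Admissible, all indices even, and consecutive indices congruent mod `p - 1`. -/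
def EvenCongruentAdmissible (w : List ℕ) : Prop :=
  (∀ i ∈ w, Even i) ∧ Admissible w ∧ w.IsChain (fun a b => a ≡ b [MOD p - 1])

end Algebras

end KudoArakiMay

end

/-!
Reduction to admissible monomials. In the Adem relation for `e_i e_j` with `i > j`, every term on
the right is an admissible product `e_a e_k` with `a < i` (`ademTerm_eq_zero_or`), so an induction
on length and first index shows that admissible monomials span (`monomial_mem_admissibleSpan`).
The residues modulo `p - 1` are interchanged, and this forces `e_i e_j = 0` when `i` and `j` are
incongruent modulo `p - 1` or odd: for `i ≤ j`, applying the relation at most twice expresses the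
product by products of the same kind with a smaller last index, except that for `i`, `j` odd and
congruent it contains `-e_i e_j`, whence `2 e_i e_j = 0` (`mul_eq_zero_of_not_modEq_or_odd`).

Independence. Let `φ` be the Frobenius, `φ x = x ^ p φ`, and consider the twisted polynomial
`(φ + t_n) ⋯ (φ + t_1) = φ ^ n + c_1 φ ^ (n - 1) + ⋯ + c_n`, whose coefficients `c_s` are Dickson
invariants. A polynomial in the `c_s` defines a linear functional on monomials of length `n`: the
value on `d_{i_1} ⋯ d_{i_n}` is the coefficient of `t_1 ^ i_1 ⋯ t_n ^ i_n`. Any two adjacent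
factors multiply to `φ ^ 2 + (t + s ^ p) φ + s t`, with `s = t_m` and `t = t_{m + 1}`, so it suffices
that the coefficients of `(s t) ^ a (t + s ^ p) ^ b` satisfy the Adem relations. That is a binomial
identity modulo `p` (`coeff_binomialSeries_mul_pow`). Splitting off one factor `φ + t` at a time
turns these functionals into operators `coeffOp` on a polynomial ring in the `c_s`, which satisfy
the Adem relations (`coeffOp_mul_coeffOp`). The leading monomial of
`c_1 ^ (i_n - i_{n-1}) ⋯ c_n ^ i_1`, for the order in which the last exponent counts most, is
`t_1 ^ i_1 ⋯ t_n ^ i_n`; so the pairing with admissible monomials is triangular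
(`linearIndependent_monomial_gradedOp`). One copy of the operators for each even residue modulo
`p - 1`, graded by length, serves all three algebras at once.
-/

noncomputable section

namespace KudoArakiMay

/-! ### A binomial identity modulo `p` -/

open PowerSeries in
/-- With `y = X (1 + X) ^ (p - 1)`, the series `(1 + X) ^ (p - 1) - X ^ p` over `𝔽_p` is `1 - y`.
By Lagrange inversion the left side is the coefficient of `y ^ N` in the expansion of
`(1 - y) ^ b` in powers of `y`; the induction on `b` is Pascal's rule. -/
theorem coeff_binomialSeries_mul_pow (p : ℕ) [Fact p.Prime] (b N : ℕ) :
    coeff N (binomialSeries (ZMod p) (-((p : ℤ) - 1) * N - 1) *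
      ((1 + X) ^ (p - 1) - X ^ p : (ZMod p)⟦X⟧) ^ b) = (-1) ^ N * (b.choose N : ZMod p) := by
  have hp : 1 ≤ p := (Fact.out : p.Prime).one_le
  have : CharP (ZMod p)⟦X⟧ p := charP_of_injective_ringHom C_injective p
  have hU : ((1 + X) ^ (p - 1) - X ^ p : (ZMod p)⟦X⟧) = 1 - X * (1 + X) ^ (p - 1) := by
    have h : (1 + X : (ZMod p)⟦X⟧) ^ (p - 1) * (1 + X) = 1 + X ^ p := by
      rw [← pow_succ, Nat.sub_add_cancel hp, add_pow_char, one_pow]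
    linear_combination h
  rw [hU]
  induction b generalizing N with
  | zero =>
    rw [pow_zero, mul_one, binomialSeries_coeff]
    cases N with
    | zero => simp
    | succ n =>
      have h : (Ring.choose (-((p : ℤ) - 1) * (n + 1 : ℕ) - 1) (n + 1) : ℤ) =
          Int.negOnePow (n + 1 : ℕ) • ((p * (n + 1)).choose (n + 1) : ℤ) := by
        rw [show (-((p : ℤ) - 1) * (n + 1 : ℕ) - 1) = -(((p : ℤ) - 1) * (n + 1 : ℕ) + 1) by ring,
          Ring.choose_neg, ← Ring.choose_natCast]
        congr 2
        push_cast
        ring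
      have h2 : (((p * (n + 1)).choose (n + 1) : ℕ) : ZMod p) = 0 := by
        rw [ZMod.natCast_eq_zero_iff]
        have h3 := Nat.add_one_mul_choose_eq (p * (n + 1) - 1) n
        rw [Nat.sub_add_cancel (Nat.mul_pos hp n.succ_pos)] at h3
        refine ⟨(p * (n + 1) - 1).choose n, Nat.eq_of_mul_eq_mul_right n.succ_pos ?_⟩
        rw [← h3]
        ring
      rw [h, Units.smul_def, smul_eq_mul, zsmul_eq_mul]
      push_cast
      rw [h2]
      simp
  | succ b ih =>
    rw [pow_succ, mul_sub, mul_one, mul_sub, map_sub, ih]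
    cases N with
    | zero => simp [mul_left_comm _ X]
    | succ N =>
      have h : binomialSeries (ZMod p) (-((p : ℤ) - 1) * N - 1) =
          binomialSeries (ZMod p) (-((p : ℤ) - 1) * (N + 1 : ℕ) - 1) * (1 + X) ^ (p - 1) := by
        rw [← binomialSeries_nat (R := ℤ), ← binomialSeries_add]
        congr 1
        push_cast [Nat.cast_sub hp]
        ring
      rw [show binomialSeries (ZMod p) (-((p : ℤ) - 1) * (N + 1 : ℕ) - 1) *
          ((1 - X * (1 + X) ^ (p - 1) : (ZMod p)⟦X⟧) ^ b * (X * (1 + X) ^ (p - 1))) =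
          X * (binomialSeries (ZMod p) (-((p : ℤ) - 1) * N - 1) *
            (1 - X * (1 + X) ^ (p - 1)) ^ b) by rw [h]; ring,
        coeff_succ_X_mul, ih, Nat.choose_succ_succ]
      push_cast
      ring

open PowerSeries in
/-- The same identity with the `b`-th power expanded, as it occurs in the Adem relations. -/
theorem sum_choose_mul_intBinom (p : ℕ) [Fact p.Prime] (b N : ℕ) :
    ∑ m ∈ Finset.range (b + 1), (-1) ^ m * (b.choose m : ZMod p) *
      (intBinom (((p : ℤ) - 1) * (b - N - m) - 1) (N - p * m) : ZMod p) =
        (-1) ^ N * (b.choose N : ZMod p) := by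
  have hp : 1 ≤ p := (Fact.out : p.Prime).one_le
  rw [← coeff_binomialSeries_mul_pow, sub_eq_neg_add (_ ^ (p - 1)), add_pow (-_),
    Finset.mul_sum, map_sum]
  refine Finset.sum_congr rfl fun m hm => ?_
  have hmb : m ≤ b := Nat.lt_succ_iff.mp (Finset.mem_range.mp hm)
  have h : binomialSeries (ZMod p) (((p : ℤ) - 1) * (b - N - m) - 1) =
      binomialSeries (ZMod p) (-((p : ℤ) - 1) * N - 1) * ((1 + X) ^ (p - 1)) ^ (b - m) := by
    rw [← pow_mul, ← binomialSeries_nat (R := ℤ), ← binomialSeries_add]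
    congr 1
    push_cast [Nat.cast_sub hp, Nat.cast_sub hmb]
    ring
  rw [show binomialSeries (ZMod p) (-((p : ℤ) - 1) * N - 1) *
      ((-X ^ p) ^ m * ((1 + X) ^ (p - 1)) ^ (b - m) * (b.choose m : (ZMod p)⟦X⟧)) =
      C ((-1) ^ m * (b.choose m : ZMod p)) *
        (X ^ (p * m) * binomialSeries (ZMod p) (((p : ℤ) - 1) * (b - N - m) - 1)) by
      rw [h, neg_pow, ← pow_mul]
      simp only [map_mul, map_pow, map_neg, map_one, map_natCast]
      ring,
    coeff_C_mul, coeff_X_pow_mul']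
  congr 1
  unfold intBinom
  by_cases hpm : p * m ≤ N
  · have h1 : (0 : ℤ) ≤ N - p * m := by
      have : ((p * m : ℕ) : ℤ) ≤ N := by exact_mod_cast hpm
      push_cast at this
      linarith
    rw [if_pos hpm, if_pos h1, binomialSeries_coeff, zsmul_eq_mul, mul_one]
    congr 3
    omega
  · have h1 : ¬ (0 : ℤ) ≤ N - p * m := by
      have : (N : ℤ) < ((p * m : ℕ) : ℤ) := by exact_mod_cast not_le.mp hpm
      push_cast at this
      linarith
    rw [if_neg hpm, if_neg h1, Int.cast_zero]

/-! ### Operators on polynomials that satisfy the Adem relations -/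

/-- The coefficients `c_0 = 1, c_1, c_2, …` of the generic monic `p`-polynomial
`φ ^ n + c_1 φ ^ (n - 1) + c_2 φ ^ (n - 2) + ⋯`; the variable `X s` is `c_{s + 1}`. -/
def dicksonCoeff (p : ℕ) : ℕ → MvPolynomial ℕ (ZMod p)
  | 0 => 1
  | s + 1 => MvPolynomial.X s

/-- Left multiplication of the generic monic `p`-polynomial by `φ + t`, where `φ x = x ^ p φ`:
it sends `c_{s + 1}` to `c_{s + 1} ^ p + t c_s`. -/
def dicksonComul (p : ℕ) :
    MvPolynomial ℕ (ZMod p) →ₐ[ZMod p] Polynomial (MvPolynomial ℕ (ZMod p)) :=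
  MvPolynomial.aeval fun s =>
    Polynomial.C (dicksonCoeff p (s + 1) ^ p) + Polynomial.X * Polynomial.C (dicksonCoeff p s)

/-- The operator that takes the coefficient of `t ^ i` in `dicksonComul`. These operators satisfy
the Adem relations. -/
def coeffOp (p i : ℕ) : Module.End (ZMod p) (MvPolynomial ℕ (ZMod p)) :=
  ((Polynomial.lcoeff (MvPolynomial ℕ (ZMod p)) i).restrictScalars (ZMod p)) ∘ₗ
    (dicksonComul p).toLinearMap

theorem coeffOp_apply (p i : ℕ) (f : MvPolynomial ℕ (ZMod p)) :
    coeffOp p i f = (dicksonComul p f).coeff i := rfl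

theorem dicksonComul_X (p s : ℕ) : dicksonComul p (MvPolynomial.X s) =
    Polynomial.C (dicksonCoeff p (s + 1) ^ p) + Polynomial.X * Polynomial.C (dicksonCoeff p s) :=
  MvPolynomial.aeval_X _ _

/-- The coefficient of the Adem relation for `d_i d_j`, with `d_i = e_{i (p - 1)}`. -/
def ademCoeff (p : ℕ) (i j : ℕ) (k : ℤ) : ZMod p :=
  (((((-1 : ℤˣ) ^ ((p : ℤ) * k - i) : ℤˣ) : ℤ) *
    intBinom (((p : ℤ) - 1) * (k - j) - 1) ((p : ℤ) * k - i - ((p : ℤ) - 1) * j) : ℤ) : ZMod p)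

section TwoVariables

variable {R : Type*} [CommRing R]

open Polynomial in
theorem coeff_coeff_mul_pow_mul_add_pow (p a b i j : ℕ) :
    (((C X * X : R[X][X]) ^ a * (X + C (X ^ p)) ^ b).coeff j).coeff i =
      ∑ m ∈ Finset.range (b + 1),
        if a + b = j + m ∧ i = a + p * m then (b.choose m : R) else 0 := by
  rw [add_comm X, add_pow, Finset.mul_sum, finsetSum_coeff, finsetSum_coeff]
  refine Finset.sum_congr rfl fun m hm => ?_
  have hmb : m ≤ b := Nat.lt_succ_iff.mp (Finset.mem_range.mp hm)
  rw [show (C X * X : R[X][X]) ^ a * (C (X ^ p) ^ m * X ^ (b - m) * (b.choose m : R[X][X])) =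
      C (C (b.choose m : R) * X ^ (a + p * m)) * X ^ (a + (b - m)) by
    simp only [map_mul, map_pow, map_natCast]
    ring, coeff_C_mul_X_pow]
  by_cases h : j = a + (b - m)
  · rw [if_pos h, coeff_C_mul_X_pow]
    refine if_congr ?_ rfl rfl
    constructor
    · intro h'; exact ⟨by omega, h'⟩
    · exact fun h' => h'.2
  · rw [if_neg h, if_neg (fun h' => h (by omega)), coeff_zero]

end TwoVariables

/-- The coefficient of `t₁ ^ i t₂ ^ j` in `(t₁ t₂) ^ a (t₂ + t₁ ^ p) ^ b`, extended by zero to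
negative `i`. -/
def pairCoeff (p a b : ℕ) (i : ℤ) (j : ℕ) : ZMod p :=
  ∑ m ∈ Finset.range (b + 1), if a + b = j + m ∧ i = a + p * m then (b.choose m : ZMod p) else 0

theorem ademCoeff_eq (p : ℕ) (hp : Odd p) (a b i j m : ℕ) (hm : m ≤ a + b)
    (h : i + p * j = (p + 1) * a + p * b) (haj : a ≤ j) :
    ademCoeff p i j ((a + b - m : ℕ) : ℤ) = (-1) ^ (j - a) * ((-1) ^ m *
      (intBinom (((p : ℤ) - 1) * (b - (j - a : ℕ) - m) - 1) ((j - a : ℕ) - p * m) : ZMod p)) := by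
  have hi : (i : ℤ) = (p + 1) * a + p * b - p * j := by
    have : ((i + p * j : ℕ) : ℤ) = (((p + 1) * a + p * b : ℕ) : ℤ) := by rw [h]
    push_cast at this
    linarith
  obtain ⟨q, hq⟩ := hp
  have hsign : ((-1 : ℤˣ) ^ ((p : ℤ) * ((a + b - m : ℕ) : ℤ) - i) : ℤˣ) =
      (-1) ^ (j - a) * (-1) ^ m := by
    have he : (p : ℤ) * ((a + b - m : ℕ) : ℤ) - i =
        ((j - a : ℕ) : ℤ) + (m : ℤ) + 2 * (q * (j - m) - m) := by
      rw [hi, hq]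
      push_cast [Nat.cast_sub hm, Nat.cast_sub haj]
      ring
    rw [he, zpow_add, zpow_add, zpow_mul, zpow_natCast, zpow_natCast]
    simp
  unfold ademCoeff
  rw [hsign, show ((p : ℤ) - 1) * (((a + b - m : ℕ) : ℤ) - j) - 1 =
      ((p : ℤ) - 1) * (b - (j - a : ℕ) - m) - 1 by
        push_cast [Nat.cast_sub hm, Nat.cast_sub haj]; ring,
    show (p : ℤ) * ((a + b - m : ℕ) : ℤ) - i - ((p : ℤ) - 1) * j = (j - a : ℕ) - p * m by
        rw [hi]; push_cast [Nat.cast_sub hm, Nat.cast_sub haj]; ring]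
  push_cast
  ring

theorem pairCoeff_adem (p : ℕ) [Fact p.Prime] (hp2 : p ≠ 2) (a b i j : ℕ) :
    pairCoeff p a b i j = ∑ k ∈ Finset.range (i + p * j + 1),
      ademCoeff p i j k * pairCoeff p a b ((i : ℤ) + p * j - p * k) k := by
  have hp : p.Prime := Fact.out
  by_cases h : i + p * j = (p + 1) * a + p * b
  · have hi : (i : ℤ) = (p + 1) * a + p * b - p * j := by
      have : ((i + p * j : ℕ) : ℤ) = (((p + 1) * a + p * b : ℕ) : ℤ) := by rw [h]
      push_cast at this
      linarith
    -- Only `k = a + b - m` contributes to the summand of index `m` on the right.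
    have hR : ∑ k ∈ Finset.range (i + p * j + 1),
        ademCoeff p i j k * pairCoeff p a b ((i : ℤ) + p * j - p * k) k =
        ∑ m ∈ Finset.range (b + 1), ademCoeff p i j ((a + b - m : ℕ) : ℤ) * b.choose m := by
      unfold pairCoeff
      simp_rw [Finset.mul_sum]
      rw [Finset.sum_comm]
      refine Finset.sum_congr rfl fun m hm => ?_
      have hmb : m ≤ b := Nat.lt_succ_iff.mp (Finset.mem_range.mp hm)
      rw [Finset.sum_eq_single (a + b - m)]
      · rw [if_pos]
        refine ⟨by omega, ?_⟩
        rw [hi]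
        push_cast [Nat.cast_sub (show m ≤ a + b by omega)]
        ring
      · intro k _ hk
        rw [if_neg (fun h' => hk (by omega)), mul_zero]
      · intro hk
        refine absurd (Finset.mem_range.mpr ?_) hk
        have : 1 * (a + b) ≤ p * (a + b) := Nat.mul_le_mul_right _ hp.one_le
        have : (p + 1) * a + p * b = p * (a + b) + a := by ring
        omega
    have hL : pairCoeff p a b i j = if a ≤ j then (b.choose (j - a) : ZMod p) else 0 := by
      unfold pairCoeff
      split_ifs with haj
      · by_cases hjb : j - a ≤ b
        · rw [Finset.sum_eq_single (a + b - j), if_pos,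
            show a + b - j = b - (j - a) by omega, Nat.choose_symm hjb]
          · refine ⟨by omega, ?_⟩
            rw [hi]
            push_cast [Nat.cast_sub (show j ≤ a + b by omega)]
            ring
          · intro m _ hm
            rw [if_neg (fun h' => hm (by omega))]
          · intro hm
            exact absurd (Finset.mem_range.mpr (by omega)) hm
        · rw [Nat.choose_eq_zero_of_lt (by omega), Nat.cast_zero]
          exact Finset.sum_eq_zero fun m hm => if_neg (by omega)
      · refine Finset.sum_eq_zero fun m hm => if_neg ?_
        have := Finset.mem_range.mp hm
        omega
    rw [hL, hR]
    split_ifs with haj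
    · have hsum := sum_choose_mul_intBinom p b (j - a)
      have hsq : ((-1 : ZMod p) ^ (j - a)) * (-1) ^ (j - a) = 1 := by
        rw [← mul_pow]; simp
      calc (b.choose (j - a) : ZMod p)
          = (-1) ^ (j - a) * ((-1) ^ (j - a) * (b.choose (j - a) : ZMod p)) := by
            rw [← mul_assoc, hsq, one_mul]
        _ = _ := by
            rw [← hsum, Finset.mul_sum]
            refine Finset.sum_congr rfl fun m hm => ?_
            have hmb : m ≤ b := Nat.lt_succ_iff.mp (Finset.mem_range.mp hm)
            rw [ademCoeff_eq p (hp.odd_of_ne_two hp2) a b i j m (by omega) h haj]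
            ring
    · refine (Finset.sum_eq_zero fun m hm => ?_).symm
      have hmb : m ≤ b := Nat.lt_succ_iff.mp (Finset.mem_range.mp hm)
      unfold ademCoeff intBinom
      rw [if_neg, mul_zero, Int.cast_zero, zero_mul]
      rw [hi]
      push_cast [Nat.cast_sub (show m ≤ a + b by omega)]
      have h1 : (0 : ℤ) ≤ p * m := by positivity
      have h2 : (j : ℤ) < a := by omega
      intro h3
      linarith
  · have h0 : ∀ (z : ℤ) (k : ℕ), z + p * k = i + p * j → pairCoeff p a b z k = 0 := by
      intro z k hz
      refine Finset.sum_eq_zero fun m _ => if_neg ?_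
      rintro ⟨h1, rfl⟩
      apply h
      have h1' : (a : ℤ) + b = k + m := by exact_mod_cast h1
      zify
      rw [← hz]
      linear_combination (-(p : ℤ)) * h1'
    rw [h0 i j rfl]
    refine (Finset.sum_eq_zero fun k _ => ?_).symm
    rw [h0 _ _ (by ring), mul_zero]

open Polynomial in
/-- The Adem relations hold for the coefficients of every polynomial in `t₁ t₂` and
`t₂ + t₁ ^ p`. -/
theorem coeff_coeff_adem (p : ℕ) [Fact p.Prime] (hp2 : p ≠ 2) {R : Type*} [CommRing R]
    [Algebra (ZMod p) R] {g : R[X][X]}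
    (hg : g ∈ Algebra.adjoin R {(C X * X : R[X][X]), X + C (X ^ p)}) (i j : ℕ) :
    (g.coeff j).coeff i = ∑ k ∈ Finset.range (i + p * j + 1), ademCoeff p i j k •
      (if 0 ≤ (i : ℤ) + p * j - p * k then
        (g.coeff k).coeff ((i : ℤ) + p * j - p * k).toNat else 0) := by
  rw [← Subalgebra.mem_toSubmodule, Algebra.adjoin_eq_span] at hg
  induction hg using Submodule.span_induction with
  | mem x hx =>
    obtain ⟨a, b, rfl⟩ := (Submonoid.mem_closure_pair _ _ _).mp hx
    have h : ∀ i k : ℕ, ((((C X * X : R[X][X]) ^ a * (X + C (X ^ p)) ^ b).coeff k).coeff i) =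
        algebraMap (ZMod p) R (pairCoeff p a b i k) := by
      intro i k
      rw [coeff_coeff_mul_pow_mul_add_pow, pairCoeff, map_sum]
      refine Finset.sum_congr rfl fun m _ => ?_
      rw [apply_ite (algebraMap (ZMod p) R), map_natCast, map_zero]
      refine if_congr (and_congr_right fun _ => ?_) rfl rfl
      norm_cast
    rw [h, pairCoeff_adem p hp2, map_sum]
    refine Finset.sum_congr rfl fun k _ => ?_
    rw [Algebra.smul_def, map_mul]
    congr 1
    split_ifs with hz
    · rw [h, Int.toNat_of_nonneg hz]
    · rw [pairCoeff, Finset.sum_eq_zero, map_zero]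
      intro m _
      refine if_neg fun h' => hz ?_
      rw [h'.2]
      positivity
  | zero => simp
  | add x y _ _ hx hy =>
    rw [coeff_add, coeff_add, hx, hy, ← Finset.sum_add_distrib]
    refine Finset.sum_congr rfl fun k _ => ?_
    rw [← smul_add]
    split_ifs <;> simp
  | smul r x _ hx =>
    rw [coeff_smul, coeff_smul, hx, Finset.smul_sum]
    refine Finset.sum_congr rfl fun k _ => ?_
    rw [smul_comm]
    split_ifs <;> simp

open Polynomial in
theorem map_dicksonComul_mem_adjoin (p : ℕ) [Fact p.Prime] (f : MvPolynomial ℕ (ZMod p)) :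
    mapAlgHom (dicksonComul p) (dicksonComul p f) ∈
      Algebra.adjoin (MvPolynomial ℕ (ZMod p))
        {(C X * X : (MvPolynomial ℕ (ZMod p))[X][X]), X + C (X ^ p)} := by
  set S := Algebra.adjoin (MvPolynomial ℕ (ZMod p))
        {(C X * X : (MvPolynomial ℕ (ZMod p))[X][X]), X + C (X ^ p)} with hS
  have hA : (C X * X : (MvPolynomial ℕ (ZMod p))[X][X]) ∈ S :=
    Algebra.subset_adjoin (by simp)
  have hB : (X + C (X ^ p) : (MvPolynomial ℕ (ZMod p))[X][X]) ∈ S :=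
    Algebra.subset_adjoin (by simp)
  have hC : ∀ r : MvPolynomial ℕ (ZMod p), (C (C r) : (MvPolynomial ℕ (ZMod p))[X][X]) ∈ S :=
    fun r => S.algebraMap_mem r
  induction f using MvPolynomial.induction_on with
  | C r =>
    rw [← MvPolynomial.algebraMap_eq, AlgHom.commutes, AlgHom.commutes,
      IsScalarTower.algebraMap_apply (ZMod p) (MvPolynomial ℕ (ZMod p))]
    exact S.algebraMap_mem _
  | add f g hf hg => rw [map_add, map_add]; exact S.add_mem hf hg
  | mul_X f s hf =>
    rw [map_mul, map_mul]
    refine S.mul_mem hf ?_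
    have hmap : ∀ q r : MvPolynomial ℕ (ZMod p), mapAlgHom (dicksonComul p) (C (q ^ p) + X * C r) =
        C (dicksonComul p q) ^ p + X * C (dicksonComul p r) := fun q r => by
      rw [coe_mapAlgHom, Polynomial.map_add, Polynomial.map_mul, map_X, map_C, map_C, map_pow,
        map_pow]
      rfl
    have hpow : ∀ x y z : (MvPolynomial ℕ (ZMod p))[X][X],
        (x + y * z) ^ p = x ^ p + y ^ p * z ^ p := fun x y z =>
      (add_pow_char x (y * z) p).trans (congrArg _ (mul_pow y z p))
    rw [dicksonComul_X, hmap, show dicksonCoeff p (s + 1) = MvPolynomial.X s from rfl,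
      dicksonComul_X, map_add, map_mul, hpow,
      show dicksonCoeff p (s + 1) = MvPolynomial.X s from rfl]
    -- `(φ + t₂) (φ + t₁) = φ ^ 2 + (t₂ + t₁ ^ p) φ + t₁ t₂`
    rcases s with _ | s
    · have h : C (C (MvPolynomial.X 0 ^ p)) ^ p + C X ^ p * C (C (dicksonCoeff p 0)) ^ p +
          X * C (dicksonComul p (dicksonCoeff p 0)) =
          (C (C ((MvPolynomial.X 0) ^ p ^ 2)) : (MvPolynomial ℕ (ZMod p))[X][X]) +
            (X + C (X ^ p)) := by
        simp only [dicksonCoeff, map_pow, map_one, mul_one, one_pow]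
        ring
      rw [h]
      exact S.add_mem (hC _) hB
    · have h : C (C (MvPolynomial.X (s + 1) ^ p)) ^ p +
          C X ^ p * C (C (dicksonCoeff p (s + 1))) ^ p +
          X * C (dicksonComul p (dicksonCoeff p (s + 1))) =
          (C (C ((MvPolynomial.X (s + 1)) ^ p ^ 2)) : (MvPolynomial ℕ (ZMod p))[X][X]) +
            C (C ((MvPolynomial.X s) ^ p)) * (X + C (X ^ p)) +
              C (C (dicksonCoeff p s)) * (C X * X) := by
        rw [show dicksonCoeff p (s + 1) = MvPolynomial.X s from rfl, dicksonComul_X,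
          show dicksonCoeff p (s + 1) = MvPolynomial.X s from rfl]
        simp only [map_add, map_pow, map_mul]
        ring
      rw [h]
      exact S.add_mem (S.add_mem (hC _) (S.mul_mem (hC _) hB)) (S.mul_mem (hC _) hA)

theorem coeffOp_mul_coeffOp (p : ℕ) [Fact p.Prime] (hp2 : p ≠ 2) (i j : ℕ) :
    coeffOp p i * coeffOp p j = ∑ k ∈ Finset.range (i + p * j + 1), ademCoeff p i j k •
      (zeroExt (coeffOp p) ((i : ℤ) + p * j - p * k) * coeffOp p k) := by
  refine LinearMap.ext fun f => ?_
  have h : ∀ i k : ℕ, coeffOp p i (coeffOp p k f) =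
      ((Polynomial.mapAlgHom (dicksonComul p) (dicksonComul p f)).coeff k).coeff i := by
    intro i k
    rw [coeffOp_apply, coeffOp_apply, Polynomial.coe_mapAlgHom, Polynomial.coeff_map]
    rfl
  rw [Module.End.mul_apply, h, coeff_coeff_adem p hp2 (map_dicksonComul_mem_adjoin p f),
    LinearMap.sum_apply]
  refine Finset.sum_congr rfl fun k _ => ?_
  rw [LinearMap.smul_apply, Module.End.mul_apply]
  congr 1
  unfold zeroExt
  split_ifs with hz
  · rw [h]
  · rfl

/-! ### Triangularity and linear independence -/

/-- The monomial in the `c_s` dual to a weakly decreasing word `a_1 ≥ a_2 ≥ ⋯`, namely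
`c_{s+1} ^ (a_1 - a_2) c_{s+2} ^ (a_2 - a_3) ⋯`. -/
def dicksonMonomial (p : ℕ) : ℕ → List ℕ → MvPolynomial ℕ (ZMod p)
  | _, [] => 1
  | s, a :: l => MvPolynomial.X s ^ (a - l.headD 0) * dicksonMonomial p (s + 1) l

section

variable (p : ℕ)

theorem headD_le_of_isChain {a : ℕ} {l : List ℕ} (h : (a :: l).IsChain (· ≥ ·)) :
    l.headD 0 ≤ a := by
  cases l with
  | nil => simp
  | cons b l => simpa using (List.isChain_cons_cons.mp h).1

open Polynomial in
theorem natDegree_dicksonComul_X_le (s : ℕ) :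
    (dicksonComul p (MvPolynomial.X s)).natDegree ≤ 1 := by
  rw [dicksonComul_X]
  refine (natDegree_add_le _ _).trans (max_le (by rw [natDegree_C]; exact zero_le_one) ?_)
  exact natDegree_mul_le.trans (by simpa using natDegree_X_le)

open Polynomial in
theorem coeff_one_dicksonComul_X (s : ℕ) :
    (dicksonComul p (MvPolynomial.X s)).coeff 1 = dicksonCoeff p s := by
  rw [dicksonComul_X, coeff_add, coeff_C_succ, coeff_X_mul, coeff_C_zero, zero_add]

theorem natDegree_dicksonComul_dicksonMonomial_le (s : ℕ) (l : List ℕ)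
    (hl : l.IsChain (· ≥ ·)) :
    (dicksonComul p (dicksonMonomial p s l)).natDegree ≤ l.headD 0 := by
  induction l generalizing s with
  | nil => simp [dicksonMonomial]
  | cons a l ih =>
    rw [dicksonMonomial, map_mul, map_pow]
    have h1 := ih (s + 1) hl.tail
    have h2 := Polynomial.natDegree_pow_le_of_le (a - l.headD 0) (natDegree_dicksonComul_X_le p s)
    have h3 := headD_le_of_isChain hl
    refine (Polynomial.natDegree_mul_le_of_le h2 h1).trans ?_
    simp only [List.headD_cons]
    omega

/-- The leading coefficient of `dicksonComul p (dicksonMonomial p s (a :: l))`. -/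
theorem coeff_dicksonComul_dicksonMonomial_cons (s a : ℕ) (l : List ℕ)
    (hl : (a :: l).IsChain (· ≥ ·)) :
    (dicksonComul p (dicksonMonomial p s (a :: l))).coeff a = dicksonCoeff p s ^ (a - l.headD 0) *
      (dicksonComul p (dicksonMonomial p (s + 1) l)).coeff (l.headD 0) := by
  have h := Polynomial.coeff_mul_add_eq_of_natDegree_le
    (Polynomial.natDegree_pow_le_of_le (a - l.headD 0) (natDegree_dicksonComul_X_le p s))
    (natDegree_dicksonComul_dicksonMonomial_le p (s + 1) l hl.tail)
  rw [Polynomial.coeff_pow_of_natDegree_le (natDegree_dicksonComul_X_le p s),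
    coeff_one_dicksonComul_X, mul_one, Nat.sub_add_cancel (headD_le_of_isChain hl)] at h
  rw [dicksonMonomial, map_mul, map_pow, h]

theorem coeff_dicksonComul_dicksonMonomial_succ (s : ℕ) (l : List ℕ) (hl : l.IsChain (· ≥ ·)) :
    (dicksonComul p (dicksonMonomial p (s + 1) l)).coeff (l.headD 0) = dicksonMonomial p s l := by
  induction l generalizing s with
  | nil => simp [dicksonMonomial]
  | cons a l ih =>
    rw [List.headD_cons, coeff_dicksonComul_dicksonMonomial_cons p _ a l hl, ih _ hl.tail]
    rfl

theorem coeffOp_dicksonMonomial_self (a : ℕ) (l : List ℕ) (hl : (a :: l).IsChain (· ≥ ·)) :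
    coeffOp p a (dicksonMonomial p 0 (a :: l)) = dicksonMonomial p 0 l := by
  rw [coeffOp_apply, coeff_dicksonComul_dicksonMonomial_cons p _ a l hl,
    coeff_dicksonComul_dicksonMonomial_succ p _ l hl.tail, dicksonCoeff, one_pow, one_mul]

theorem coeffOp_dicksonMonomial_of_lt {a b : ℕ} (l : List ℕ) (hl : (a :: l).IsChain (· ≥ ·))
    (hab : a < b) : coeffOp p b (dicksonMonomial p 0 (a :: l)) = 0 :=
  Polynomial.coeff_eq_zero_of_natDegree_lt
    ((natDegree_dicksonComul_dicksonMonomial_le p 0 _ hl).trans_lt hab)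

/-- The operators through which the `e_i` act: one copy of the polynomial ring for each `r`, on
which `e_{r + (p - 1) m}` acts as the `m`-th operator `coeffOp` if its index is even, and the other
`e_i` act as zero. Only the remainders `r < p - 1` give nonzero operators. -/
def residueOp (i : ℕ) : ℕ → Module.End (ZMod p) (MvPolynomial ℕ (ZMod p)) :=
  fun r => if i % (p - 1) = r ∧ Even i then coeffOp p (i / (p - 1)) else 0

variable {p}

theorem residueOp_eq_zero_of_odd {i : ℕ} (hi : ¬ Even i) : residueOp p i = 0 :=
  funext fun _ => if_neg fun h => hi h.2

theorem monomial_residueOp_reverse_self (r : ℕ) (u : List ℕ) (hu : u.IsChain (· ≥ ·))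
    (hr : ∀ a ∈ u, a % (p - 1) = r ∧ Even a) :
    monomial (residueOp p) u.reverse r (dicksonMonomial p 0 (u.map (· / (p - 1)))) = 1 := by
  induction u with
  | nil => rfl
  | cons a l ih =>
    have hc : ((a / (p - 1)) :: l.map (· / (p - 1))).IsChain (· ≥ ·) := by
      rw [← List.map_cons (f := (· / (p - 1))), List.isChain_map]
      exact hu.imp fun _ _ h => Nat.div_le_div_right h
    have ha := hr a List.mem_cons_self
    rw [List.reverse_cons, monomial, List.map_append, List.prod_append, List.map_singleton,
      List.prod_singleton, Pi.mul_apply, Module.End.mul_apply, residueOp, if_pos ha, List.map_cons,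
      coeffOp_dicksonMonomial_self p _ _ hc]
    exact ih hu.tail fun b hb => hr b (List.mem_cons_of_mem _ hb)

theorem monomial_residueOp_reverse_of_lt (r : ℕ) (u v : List ℕ) (hu : u.IsChain (· ≥ ·))
    (hr : ∀ a ∈ u, a % (p - 1) = r ∧ Even a) (hlen : u.length = v.length) (huv : u < v) :
    monomial (residueOp p) v.reverse r (dicksonMonomial p 0 (u.map (· / (p - 1)))) = 0 := by
  induction u generalizing v with
  | nil =>
    rw [List.length_nil, eq_comm, List.length_eq_zero_iff] at hlen
    exact absurd huv (by simp [hlen])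
  | cons a l ih =>
    cases v with
    | nil => simp at hlen
    | cons b m =>
      have hc : ((a / (p - 1)) :: l.map (· / (p - 1))).IsChain (· ≥ ·) := by
        rw [← List.map_cons (f := (· / (p - 1))), List.isChain_map]
        exact hu.imp fun _ _ h => Nat.div_le_div_right h
      have ha := hr a List.mem_cons_self
      rw [List.reverse_cons, monomial, List.map_append, List.prod_append, List.map_singleton,
        List.prod_singleton, Pi.mul_apply, Module.End.mul_apply, residueOp, List.map_cons]
      rcases List.cons_lt_cons_iff.mp huv with hab | ⟨rfl, hlm⟩
      · split_ifs with hb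
        · rw [coeffOp_dicksonMonomial_of_lt p _ hc, map_zero]
          by_contra hle
          have h1 := Nat.div_add_mod a (p - 1)
          have h2 := Nat.div_add_mod b (p - 1)
          have h3 := Nat.mul_le_mul_left (p - 1) (not_lt.mp hle)
          omega
        · rw [LinearMap.zero_apply, map_zero]
      · rw [if_pos ha, coeffOp_dicksonMonomial_self p _ _ hc]
        exact ih m hu.tail (fun b hb => hr b (List.mem_cons_of_mem _ hb)) (by simpa using hlen) hlm

end

theorem linearIndependent_of_triangular {ι K V M α : Type*} [Field K] [AddCommGroup V] [Module K V]
    [AddCommGroup M] [Module K M] [LinearOrder α] (key : ι → α) (v : ι → V) (φ : ι → V →ₗ[K] M)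
    (hself : ∀ i, φ i (v i) ≠ 0) (hlt : ∀ i j, j ≠ i → ¬ key j < key i → φ i (v j) = 0) :
    LinearIndependent K v := by
  classical
  rw [linearIndependent_iff']
  intro s g hg
  by_contra! hne
  obtain ⟨i, hi, hgi⟩ := hne
  obtain ⟨m, hm, hmin⟩ := (s.filter (g · ≠ 0)).exists_min_image key ⟨i, by simp [hi, hgi]⟩
  rw [Finset.mem_filter] at hm
  have h := congrArg (φ m) hg
  rw [map_sum, map_zero, Finset.sum_eq_single m] at h
  · rw [map_smul] at h
    exact (smul_ne_zero hm.2 (hself m)) h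
  · intro j hj hjm
    rw [map_smul]
    by_cases hgj : g j = 0
    · rw [hgj, zero_smul]
    · rw [hlt m j hjm (not_lt.mpr (hmin j (by simp [hj, hgj]))), smul_zero]
  · exact fun h' => absurd hm.1 h'

/-- The algebra of polynomials over operators, in which the degree records the length of words. -/
def OpAlgebra (p : ℕ) : Type :=
  Polynomial (ℕ → Module.End (ZMod p) (MvPolynomial ℕ (ZMod p)))

instance (p : ℕ) : Ring (OpAlgebra p) :=
  inferInstanceAs (Ring (Polynomial (ℕ → Module.End (ZMod p) (MvPolynomial ℕ (ZMod p)))))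

instance (p : ℕ) : Algebra (ZMod p) (OpAlgebra p) :=
  inferInstanceAs (Algebra (ZMod p)
    (Polynomial (ℕ → Module.End (ZMod p) (MvPolynomial ℕ (ZMod p)))))

/-- The operators `residueOp`, graded by the length of words. -/
def gradedOp (p i : ℕ) : OpAlgebra p :=
  Polynomial.monomial 1 (residueOp p i)

theorem monomial_gradedOp (p : ℕ) (w : List ℕ) : monomial (gradedOp p) w =
    Polynomial.monomial w.length (monomial (residueOp p) w) := by
  induction w with
  | nil => rfl
  | cons a w ih =>
    rw [monomial, List.map_cons, List.prod_cons]
    change gradedOp p a * monomial (gradedOp p) w = _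
    rw [ih, List.length_cons, add_comm]
    exact Polynomial.monomial_mul_monomial 1 w.length (residueOp p a) (monomial (residueOp p) w)

theorem EvenCongruentAdmissible.mod_eq {p : ℕ} {w : List ℕ} (hw : EvenCongruentAdmissible p w) :
    ∀ a ∈ w, a % (p - 1) = w.headD 0 % (p - 1) := by
  have : Std.Refl (fun a b : ℕ => a ≡ b [MOD p - 1]) := ⟨fun _ => rfl⟩
  have : IsTrans ℕ (fun a b : ℕ => a ≡ b [MOD p - 1]) := ⟨fun _ _ _ => Nat.ModEq.trans⟩
  have h := List.isChain_iff_pairwise.mp hw.2.2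
  cases w with
  | nil => simp
  | cons b w =>
    intro a ha
    rcases List.mem_cons.mp ha with rfl | ha
    · rfl
    · exact ((List.pairwise_cons.mp h).1 a ha).symm

/-- The linear map that applies the component at the residue `r` of the length `n` coefficient to
the polynomial `f`. -/
def applyCoeff (p n r : ℕ) (f : MvPolynomial ℕ (ZMod p)) :
    OpAlgebra p →ₗ[ZMod p] MvPolynomial ℕ (ZMod p) where
  toFun x := Polynomial.coeff x n r f
  map_add' x y := congrFun (congrArg DFunLike.coe
    (congrFun (Polynomial.coeff_add (R := ℕ → Module.End (ZMod p) _) x y n) r)) f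
  map_smul' c x := congrFun (congrArg DFunLike.coe
    (congrFun (Polynomial.coeff_smul (R := ℕ → Module.End (ZMod p) _) c x n) r)) f

theorem applyCoeff_monomial_gradedOp (p n r : ℕ) (f : MvPolynomial ℕ (ZMod p)) (w : List ℕ) :
    applyCoeff p n r f (monomial (gradedOp p) w) =
      if w.length = n then monomial (residueOp p) w r f else 0 := by
  refine (congrArg (applyCoeff p n r f) (monomial_gradedOp p w)).trans ?_
  change (Polynomial.monomial w.length (monomial (residueOp p) w)).coeff n r f = _
  rw [Polynomial.coeff_monomial]
  split_ifs <;> rfl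

theorem linearIndependent_monomial_gradedOp (p : ℕ) [Fact p.Prime] :
    LinearIndependent (ZMod p) fun w : {w : List ℕ // EvenCongruentAdmissible p w} =>
      monomial (gradedOp p) w.1 := by
  refine linearIndependent_of_triangular (fun w => w.1.reverse) _ (fun w =>
    applyCoeff p w.1.length (w.1.headD 0 % (p - 1))
      (dicksonMonomial p 0 (w.1.reverse.map (· / (p - 1))))) ?_ ?_
  · intro ⟨w, hw⟩
    have h := monomial_residueOp_reverse_self (p := p) (w.headD 0 % (p - 1)) w.reverse
      (List.isChain_reverse.mpr hw.2.1)
      (fun a ha => ⟨hw.mod_eq a (List.mem_reverse.mp ha), hw.1 a (List.mem_reverse.mp ha)⟩)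
    rw [List.reverse_reverse] at h
    dsimp only
    rw [applyCoeff_monomial_gradedOp, if_pos rfl, h]
    exact one_ne_zero
  · intro ⟨w, hw⟩ ⟨v, hv⟩ hne hlt
    dsimp only
    rw [applyCoeff_monomial_gradedOp]
    split_ifs with hlen
    · have hwv : w.reverse < v.reverse := by
        refine lt_of_le_of_ne (not_lt.mp hlt) fun h => hne ?_
        exact Subtype.ext (List.reverse_injective h).symm
      have h := monomial_residueOp_reverse_of_lt (p := p) (w.headD 0 % (p - 1)) w.reverse v.reverse
        (List.isChain_reverse.mpr hw.2.1)
        (fun a ha => ⟨hw.mod_eq a (List.mem_reverse.mp ha), hw.1 a (List.mem_reverse.mp ha)⟩)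
        (by simp [hlen]) hwv
      rwa [List.reverse_reverse] at h
    · rfl

/-! ### The shape of the Adem relations, and the operator algebra -/

section

variable {p : ℕ} {A : Type*} [Ring A] [Algebra (ZMod p) A]

theorem zeroExt_natCast (e : ℕ → A) (i : ℕ) : zeroExt e i = e i := by
  rw [zeroExt, if_pos (Int.natCast_nonneg i), Int.toNat_natCast]

/-- A nonzero term of the Adem relation for `e_i e_j` is a multiple of some `e_a e_k`, where the
residues modulo `p - 1` have been interchanged. If `i > j`, then `j < k` and `a < k < i`; if
`i ≤ j`, then both `a` and `k` are at most `j`. -/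
theorem ademTerm_eq_zero_or (hp : 2 ≤ p) (e : ℕ → A) (i j : ℕ) (k : ℕ) :
    ademTerm p e i j k = 0 ∨ ∃ (c : ZMod p) (a : ℕ), ademTerm p e i j k = c • (e a * e k) ∧
      k ≡ i [MOD p - 1] ∧ a ≡ j [MOD p - 1] ∧
      (j < i → j < k ∧ a < k ∧ k < i) ∧ (i ≤ j → k ≤ j ∧ a ≤ j) := by
  by_cases hd : ((p : ℤ) - 1) ∣ ((p : ℤ) * k - i)
  swap
  · exact Or.inl (if_neg hd)
  by_cases hz : 0 ≤ (i : ℤ) + p * j - p * k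
  swap
  · refine Or.inl ?_
    rw [ademTerm, if_pos hd, zeroExt, if_neg hz, zero_mul, smul_zero]
  obtain ⟨q, hq⟩ := hd
  have hp1 : (0 : ℤ) < (p : ℤ) - 1 := by
    have : (2 : ℤ) ≤ p := by exact_mod_cast hp
    linarith
  have hqd : ((p : ℤ) * k - i) / ((p : ℤ) - 1) = q := by
    rw [hq, Int.mul_ediv_cancel_left _ hp1.ne']
  by_cases hb : intBinom ((k : ℤ) - j - 1) (q - j) = 0
  · refine Or.inl ?_
    rw [ademTerm, hqd, hb]
    simp
  obtain ⟨a, ha⟩ := Int.eq_ofNat_of_zero_le hz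
  have hqj : (j : ℤ) ≤ q := by
    by_contra h
    exact hb (if_neg (by linarith))
  have hkq : (j : ℤ) < k → q ≤ k - 1 := by
    intro hjk
    by_contra h
    apply hb
    obtain ⟨n, hn⟩ := Int.eq_ofNat_of_zero_le (show (0 : ℤ) ≤ k - j - 1 by linarith)
    rw [intBinom, if_pos (by linarith), hn, Ring.choose_natCast,
      Nat.choose_eq_zero_of_lt (by omega), Nat.cast_zero]
  have hcast : ((p - 1 : ℕ) : ℤ) = (p : ℤ) - 1 := by
    push_cast [Nat.cast_sub (show 1 ≤ p by omega)]
    ring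
  have hqj' : ((p : ℤ) - 1) * j ≤ ((p : ℤ) - 1) * q := mul_le_mul_of_nonneg_left hqj hp1.le
  have hji : (j : ℤ) < k → (k : ℤ) + ((p : ℤ) - 1) ≤ i := by
    intro hjk
    have := mul_le_mul_of_nonneg_left (hkq hjk) hp1.le
    linarith
  have hij : (k : ℤ) ≤ j → (i : ℤ) ≤ j := by
    intro hkj
    have := mul_le_mul_of_nonneg_left hkj (show (0 : ℤ) ≤ p by linarith)
    linarith
  have hterm : ∃ c : ZMod p, ademTerm p e i j k = c • (e a * e k) :=
    ⟨_, by rw [ademTerm, if_pos ⟨q, hq⟩, ha, zeroExt_natCast, zeroExt_natCast]⟩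
  obtain ⟨c, hc⟩ := hterm
  refine Or.inr ⟨c, a, hc, ?_, ?_, ?_, ?_⟩
  · rw [← Int.natCast_modEq_iff, Int.modEq_iff_dvd, hcast]
    exact ⟨k - q, by linarith⟩
  · rw [← Int.natCast_modEq_iff, Int.modEq_iff_dvd, hcast]
    refine ⟨q - j, ?_⟩
    linarith
  · intro h
    have hjk : (j : ℤ) < k := by
      by_contra h'
      have := hij (not_lt.mp h')
      omega
    have h3 := hji hjk
    refine ⟨by omega, ?_, by omega⟩
    by_contra hak
    have hak' : (k : ℤ) ≤ i + p * j - p * k := by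
      rw [ha]
      exact_mod_cast not_lt.mp hak
    have h5 := mul_le_mul_of_nonneg_left hak' (show (0 : ℤ) ≤ p by linarith)
    have h6 : ((p : ℤ) + 1) * (i + ((p : ℤ) - 1) * j) ≤ ((p : ℤ) + 1) * (p * k) :=
      mul_le_mul_of_nonneg_left (by linarith) (by linarith)
    have h7 : (j : ℤ) < i := by exact_mod_cast h
    nlinarith
  · intro h
    have hkj : (k : ℤ) ≤ j := by
      by_contra h'
      have := hji (not_le.mp h')
      omega
    refine ⟨by omega, ?_⟩
    have : (a : ℤ) ≤ j := by
      rw [← ha]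
      linarith
    exact_mod_cast this

theorem ademRHS_congr (hp : 2 ≤ p) {e e' : ℕ → A} {i j : ℕ}
    (h : ∀ a b : ℕ, a ≡ j [MOD p - 1] → b ≡ i [MOD p - 1] → e a * e b = e' a * e' b) :
    ademRHS p e i j = ademRHS p e' i j := by
  refine Finset.sum_congr rfl fun k _ => ?_
  unfold ademTerm
  split_ifs with hd
  · congr 1
    rw [zeroExt_natCast, zeroExt_natCast]
    unfold zeroExt
    split_ifs with hz
    · have hcast : ((p - 1 : ℕ) : ℤ) = (p : ℤ) - 1 := by
        push_cast [Nat.cast_sub (show 1 ≤ p by omega)]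
        ring
      obtain ⟨q, hq⟩ := hd
      apply h
      · rw [← Int.natCast_modEq_iff, Int.modEq_iff_dvd, hcast, Int.toNat_of_nonneg hz]
        exact ⟨q - j, by linarith⟩
      · rw [← Int.natCast_modEq_iff, Int.modEq_iff_dvd, hcast]
        exact ⟨k - q, by linarith⟩
    · rw [zero_mul, zero_mul]
  · rfl

theorem ademRHS_zero (i j : ℕ) : ademRHS p (fun _ => (0 : A)) i j = 0 := by
  refine Finset.sum_eq_zero fun k _ => ?_
  simp [ademTerm, zeroExt]

theorem map_ademRHS_of_map_mul {B : Type*} [Ring B] [Algebra (ZMod p) B] (f : A →ₗ[ZMod p] B)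
    (e : ℕ → A) (e' : ℕ → B) (h : ∀ a b, f (e a * e b) = e' a * e' b) (i j : ℕ) :
    f (ademRHS p e i j) = ademRHS p e' i j := by
  rw [ademRHS, map_sum]
  refine Finset.sum_congr rfl fun k _ => ?_
  unfold ademTerm zeroExt
  split_ifs <;> simp [h]

end

section

variable (p : ℕ) [Fact p.Prime]

theorem even_iff_of_modEq {p : ℕ} [Fact p.Prime] (hp2 : p ≠ 2) {a b : ℕ}
    (h : a ≡ b [MOD p - 1]) : Even a ↔ Even b := by
  have heven : Even (p - 1) := (Fact.out : p.Prime).even_sub_one hp2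
  rw [Nat.even_iff, Nat.even_iff, h.of_dvd heven.two_dvd]

theorem residueOp_add_mul (hp2 : p ≠ 2) {r : ℕ} (hr : r < p - 1) (hre : Even r) (m : ℕ) :
    residueOp p (r + (p - 1) * m) r = coeffOp p m := by
  have heven : Even (p - 1) := (Fact.out : p.Prime).even_sub_one hp2
  rw [residueOp, if_pos, Nat.add_mul_div_left _ _ (by omega), Nat.div_eq_of_lt hr, zero_add]
  exact ⟨by rw [Nat.add_mul_mod_self_left, Nat.mod_eq_of_lt hr], hre.add (heven.mul_right m)⟩

/-- Writing `i = r + (p - 1) m` turns the Adem relations between the even `e_i` of residue `r`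
into those between the `d_m`. -/
theorem ademTerm_residueOp (hp2 : p ≠ 2) {r : ℕ} (hr : r < p - 1) (hre : Even r) (i j : ℕ)
    (k : ℕ) : ademTerm p (residueOp p) (r + (p - 1) * i) (r + (p - 1) * j)
      ((r + (p - 1) * k : ℕ) : ℤ) r =
      ademCoeff p i j k • (zeroExt (coeffOp p) ((i : ℤ) + p * j - p * k) * coeffOp p k) := by
  have hp : p.Prime := Fact.out
  have hcast : ((p - 1 : ℕ) : ℤ) = (p : ℤ) - 1 := by
    push_cast [Nat.cast_sub hp.one_le]
    ring
  have hp1 : (0 : ℤ) < (p : ℤ) - 1 := by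
    rw [← hcast]
    omega
  have hop := residueOp_add_mul p hp2 hr hre
  have hz : ∀ z : ℤ, zeroExt (residueOp p) (r + ((p : ℤ) - 1) * z) r = zeroExt (coeffOp p) z := by
    intro z
    by_cases h0 : 0 ≤ z
    · obtain ⟨m, rfl⟩ := Int.eq_ofNat_of_zero_le h0
      rw [← hcast, show (r : ℤ) + ((p - 1 : ℕ) : ℤ) * (m : ℤ) = ((r + (p - 1) * m : ℕ) : ℤ) by
        push_cast; ring, zeroExt_natCast, hop, zeroExt_natCast]
    · have h1 : ¬ 0 ≤ (r : ℤ) + ((p : ℤ) - 1) * z := by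
        have h2 : (r : ℤ) < (p : ℤ) - 1 := by
          rw [← hcast]
          exact_mod_cast hr
        have h3 : ((p : ℤ) - 1) * z ≤ ((p : ℤ) - 1) * (-1) :=
          mul_le_mul_of_nonneg_left (by omega) hp1.le
        linarith
      rw [zeroExt, if_neg h1, zeroExt, if_neg h0]
      rfl
  have hq : (p : ℤ) * ((r + (p - 1) * k : ℕ) : ℤ) - ((r + (p - 1) * i : ℕ) : ℤ) =
      ((p : ℤ) - 1) * ((p : ℤ) * k - i + r) := by
    push_cast [hcast]
    ring
  rw [ademTerm, hq, if_pos (Dvd.intro _ rfl), Int.mul_ediv_cancel_left _ hp1.ne', zpow_add,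
    zpow_natCast, hre.neg_one_pow, mul_one, zeroExt_natCast, Pi.smul_apply, Pi.mul_apply, hop,
    show ((r + (p - 1) * i : ℕ) : ℤ) + p * ((r + (p - 1) * j : ℕ) : ℤ) -
      p * ((r + (p - 1) * k : ℕ) : ℤ) = r + ((p : ℤ) - 1) * ((i : ℤ) + p * j - p * k) by
      push_cast [hcast]; ring, hz, ademCoeff,
    show ((r + (p - 1) * k : ℕ) : ℤ) - ((r + (p - 1) * j : ℕ) : ℤ) - 1 =
      ((p : ℤ) - 1) * (k - j) - 1 by push_cast [hcast]; ring,
    show (p : ℤ) * k - i + r - ((r + (p - 1) * j : ℕ) : ℤ) =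
      (p : ℤ) * k - i - ((p : ℤ) - 1) * j by push_cast [hcast]; ring]

theorem residueOp_mul_residueOp (hp2 : p ≠ 2) (i j : ℕ) :
    residueOp p i * residueOp p j = ademRHS p (residueOp p) i j := by
  have hp : p.Prime := Fact.out
  have hp1 : 0 < p - 1 := Nat.sub_pos_of_lt hp.one_lt
  have hpar : ∀ a b : ℕ, a ≡ b [MOD p - 1] → (Even a ↔ Even b) :=
    fun _ _ h => even_iff_of_modEq hp2 h
  funext r
  by_cases h : (i % (p - 1) = r ∧ Even i) ∧ (j % (p - 1) = r ∧ Even j)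
  · obtain ⟨⟨hi, hie⟩, ⟨hj, -⟩⟩ := h
    have hr : r < p - 1 := hi ▸ Nat.mod_lt _ hp1
    have hre : Even r := by rwa [← hpar i r (by rw [Nat.ModEq, hi, Nat.mod_eq_of_lt hr])]
    obtain ⟨I, rfl⟩ : ∃ I, i = r + (p - 1) * I := ⟨i / (p - 1), by rw [← hi, Nat.mod_add_div]⟩
    obtain ⟨J, rfl⟩ : ∃ J, j = r + (p - 1) * J := ⟨j / (p - 1), by rw [← hj, Nat.mod_add_div]⟩
    have hop := residueOp_add_mul p hp2 hr hre
    rw [Pi.mul_apply, hop, hop, coeffOp_mul_coeffOp p hp2, ademRHS, Finset.sum_apply]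
    have hle : r + (p - 1) * (I + p * J) ≤
        r + (p - 1) * I + p * (r + (p - 1) * J) := by
      have : (p - 1) * (p * J) = p * ((p - 1) * J) := by ring
      rw [mul_add, mul_add, this]
      omega
    refine Finset.sum_of_injOn (fun k => r + (p - 1) * k) ?_ ?_ ?_ ?_
    · intro a _ b _ hab
      exact Nat.eq_of_mul_eq_mul_left hp1 (Nat.add_left_cancel hab)
    · intro k hk
      have hk' := Nat.mul_le_mul_left (p - 1) (Nat.lt_succ_iff.mp (Finset.mem_range.mp hk))
      refine Finset.mem_coe.mpr (Finset.mem_range.mpr ?_)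
      change r + (p - 1) * k < _
      omega
    · intro k _ hk
      rcases ademTerm_eq_zero_or hp.two_le (residueOp p) (r + (p - 1) * I) (r + (p - 1) * J) k with
        h0 | ⟨c, a, h0, hki, -⟩
      · rw [h0]; rfl
      · have hkr : k % (p - 1) = r := by rw [hki, hi]
        have hk2 : k = r + (p - 1) * (k / (p - 1)) := by rw [← hkr, Nat.mod_add_div]
        have hk3 : I + p * J < k / (p - 1) := by
          by_contra hlt
          exact hk ⟨k / (p - 1), Finset.mem_coe.mpr (Finset.mem_range.mpr (by omega)), hk2.symm⟩
        rw [hk2, ademTerm_residueOp p hp2 hr hre, zeroExt, if_neg, zero_mul, smul_zero]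
        have h1 : (I : ℤ) + p * J < (k / (p - 1) : ℕ) := by exact_mod_cast hk3
        have h2 : (1 : ℤ) * (k / (p - 1) : ℕ) ≤ p * (k / (p - 1) : ℕ) :=
          mul_le_mul_of_nonneg_right (by exact_mod_cast hp.one_le) (Int.natCast_nonneg _)
        linarith
    · intro k _
      exact (ademTerm_residueOp p hp2 hr hre I J k).symm
  · have hzero : ∀ a b : ℕ, a ≡ j [MOD p - 1] → b ≡ i [MOD p - 1] →
        residueOp p a r * residueOp p b r = 0 := by
      intro a b ha hb
      unfold residueOp
      split_ifs with h1 h2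
      · refine absurd ⟨⟨?_, ?_⟩, ?_, ?_⟩ h
        · rw [← hb, h2.1]
        · rw [← hpar b i hb]; exact h2.2
        · rw [← ha, h1.1]
        · rw [← hpar a j ha]; exact h1.2
      all_goals simp
    have hL : residueOp p i r * residueOp p j r = 0 := by
      unfold residueOp
      split_ifs with h1 h2
      · exact absurd ⟨h1, h2⟩ h
      all_goals simp
    rw [Pi.mul_apply, hL]
    have hmap := map_ademRHS_of_map_mul (p := p)
      (LinearMap.proj r : (ℕ → Module.End (ZMod p) (MvPolynomial ℕ (ZMod p))) →ₗ[ZMod p] _)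
      (residueOp p) (fun a => residueOp p a r) (fun _ _ => rfl) i j
    rw [LinearMap.proj_apply] at hmap
    rw [hmap, ademRHS_congr hp.two_le (e' := fun _ => 0), ademRHS_zero]
    intro a b ha hb
    rw [hzero a b ha hb, zero_mul]

theorem gradedOp_mul_gradedOp (hp2 : p ≠ 2) (i j : ℕ) :
    gradedOp p i * gradedOp p j = ademRHS p (gradedOp p) i j := by
  have h : ∀ a b, gradedOp p a * gradedOp p b =
      (Polynomial.monomial 2 (residueOp p a * residueOp p b) : Polynomial _) :=
    fun a b => Polynomial.monomial_mul_monomial 1 1 _ _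
  let f : (ℕ → Module.End (ZMod p) (MvPolynomial ℕ (ZMod p))) →ₗ[ZMod p] OpAlgebra p :=
    { toFun := fun x => (Polynomial.monomial 2 x : Polynomial _)
      map_add' := fun x y => (Polynomial.monomial 2).map_add x y
      map_smul' := fun c x => (Polynomial.smul_monomial c 2 x).symm }
  rw [h, residueOp_mul_residueOp p hp2]
  exact map_ademRHS_of_map_mul f (residueOp p) (gradedOp p) (fun a b => (h a b).symm) i j

end

/-! ### Vanishing products and spanning by admissible monomials -/

section

variable {p : ℕ} [Fact p.Prime] {A : Type*} [Ring A] [Algebra (ZMod p) A]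

/-- The term with index `k = j` of the Adem relation for `e_i e_j`. -/
theorem ademTerm_self (e : ℕ → A) {i j : ℕ} (hij : i ≤ j) (h : i ≡ j [MOD p - 1]) :
    ademTerm p e i j j = (-1 : ZMod p) ^ j • (e i * e j) := by
  have hp : p.Prime := Fact.out
  have hcast : ((p - 1 : ℕ) : ℤ) = (p : ℤ) - 1 := by
    push_cast [Nat.cast_sub hp.one_le]
    ring
  have hp1 : (p : ℤ) - 1 ≠ 0 := by
    have : (2 : ℤ) ≤ p := by exact_mod_cast hp.two_le
    linarith
  obtain ⟨t, ht⟩ := (Nat.modEq_iff_dvd' hij).mp h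
  have hj : (j : ℤ) = i + ((p : ℤ) - 1) * t := by
    rw [← hcast]
    have : j = i + (p - 1) * t := by omega
    exact_mod_cast this
  have hq : (p : ℤ) * j - i = ((p : ℤ) - 1) * (j + t) := by linear_combination hj
  have hb : intBinom ((j : ℤ) - j - 1) (j + t - j) = (-1) ^ t := by
    rw [intBinom, if_pos (by linarith [Int.natCast_nonneg t]),
      show ((j : ℤ) + t - j).toNat = t by omega, show (j : ℤ) - j - 1 = -1 by ring, Ring.choose_neg,
      show (1 : ℤ) + t - 1 = (t : ℕ) by ring, Ring.choose_natCast, Nat.choose_self,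
      Units.smul_def, Int.negOnePow_def, zpow_natCast]
    simp
  rw [ademTerm, hq, if_pos (Dvd.intro _ rfl), Int.mul_ediv_cancel_left _ hp1, hb, zeroExt_natCast,
    show (i : ℤ) + p * j - p * j = i by ring, zeroExt_natCast]
  congr 1
  rw [zpow_add, zpow_natCast, zpow_natCast]
  push_cast
  rw [mul_assoc, ← mul_pow]
  simp

section Vanishing

variable {e : ℕ → A} {S : Set ℕ}

/-- The Adem relations annihilate the admissible products `e_i e_j` with `i` and `j` incongruent
modulo `p - 1`, or both odd. Applying them twice expresses such a product by admissible ones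
of the same kind with a smaller last index, apart from the term `(-1) ^ j e_i e_j` that is present
for `i` and `j` congruent, where `(-1) ^ j = -1`. -/
theorem mul_eq_zero_of_le (hp2 : p ≠ 2) (hS : ∀ a ∈ S, ∀ b, a ≡ b [MOD p - 1] → b ∈ S)
    (he : ∀ i ∈ S, ∀ j ∈ S, e i * e j = ademRHS p e i j) (j : ℕ) :
    ∀ i, i ≤ j → i ∈ S → j ∈ S → ¬ (i ≡ j [MOD p - 1] ∧ Even i) → e i * e j = 0 := by
  have hp : p.Prime := Fact.out
  induction j using Nat.strong_induction_on with
  | _ j ih =>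
  intro i hij hi hj hbad
  have hterm : ∀ k : ℕ, k ≠ j → ademTerm p e i j k = 0 := by
    intro k hkj
    rcases ademTerm_eq_zero_or hp.two_le e i j k with h0 | ⟨c, a, h0, hki, haj, -, hle⟩
    · exact h0
    obtain ⟨hkj', haj'⟩ := hle hij
    have hkS : k ∈ S := hS i hi k hki.symm
    have haS : a ∈ S := hS j hj a haj.symm
    have hbad' : ¬ (a ≡ k [MOD p - 1] ∧ Even a) := fun h => hbad
      ⟨hki.symm.trans (h.1.symm.trans haj),
        (even_iff_of_modEq hp2 (h.1.trans hki)).mp h.2⟩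
    rw [h0]
    rcases le_or_gt a k with hak | hak
    · rw [ih k (by omega) a hak haS hkS hbad', smul_zero]
    · rw [he a haS k hkS, ademRHS, Finset.sum_eq_zero, smul_zero]
      intro m _
      rcases ademTerm_eq_zero_or hp.two_le e a k m with h1 | ⟨d, b, h1, hma, hbk, hlt, -⟩
      · exact h1
      · obtain ⟨-, hbm, hma'⟩ := hlt hak
        rw [h1, ih m (by omega) b hbm.le (hS k hkS b hbk.symm) (hS a haS m hma.symm), smul_zero]
        exact fun h => hbad' ⟨hma.symm.trans (h.1.symm.trans hbk),
          (even_iff_of_modEq hp2 (h.1.trans hma)).mp h.2⟩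
  have hsum : e i * e j = ademTerm p e i j j := by
    rw [he i hi j hj, ademRHS]
    refine Finset.sum_eq_single j (fun k _ hk => hterm k hk) fun hk => ?_
    refine absurd (Finset.mem_range.mpr ?_) hk
    have := Nat.mul_le_mul_right j hp.one_le
    omega
  by_cases hmod : i ≡ j [MOD p - 1]
  · have hodd : Odd j := by
      rw [← Nat.not_even_iff_odd, ← even_iff_of_modEq hp2 hmod]
      exact fun h => hbad ⟨hmod, h⟩
    rw [ademTerm_self e hij hmod, hodd.neg_one_pow, neg_smul, one_smul] at hsum
    have h2 : (2 : ZMod p) • (e i * e j) = 0 := by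
      rw [two_smul]
      nth_rewrite 1 [hsum]
      exact neg_add_cancel _
    have h2' : (2 : ZMod p) ≠ 0 := by
      intro h
      have h3 : ((2 : ℕ) : ZMod p) = 0 := by exact_mod_cast h
      rw [ZMod.natCast_eq_zero_iff] at h3
      exact hp2 ((Nat.prime_dvd_prime_iff_eq hp Nat.prime_two).mp h3)
    exact (smul_eq_zero.mp h2).resolve_left h2'
  · rw [hsum]
    rcases ademTerm_eq_zero_or hp.two_le e i j j with h0 | ⟨_, _, _, hki, _⟩
    · exact h0
    · exact absurd hki.symm hmod

theorem mul_eq_zero_of_not_modEq_or_odd (hp2 : p ≠ 2)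
    (hS : ∀ a ∈ S, ∀ b, a ≡ b [MOD p - 1] → b ∈ S)
    (he : ∀ i ∈ S, ∀ j ∈ S, e i * e j = ademRHS p e i j) {i j : ℕ} (hi : i ∈ S) (hj : j ∈ S)
    (hbad : ¬ (i ≡ j [MOD p - 1] ∧ Even i)) : e i * e j = 0 := by
  have hp : p.Prime := Fact.out
  rcases le_or_gt i j with hij | hij
  · exact mul_eq_zero_of_le hp2 hS he j i hij hi hj hbad
  · rw [he i hi j hj, ademRHS, Finset.sum_eq_zero]
    intro k _
    rcases ademTerm_eq_zero_or hp.two_le e i j k with h0 | ⟨c, a, h0, hki, haj, hlt, -⟩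
    · exact h0
    · rw [h0, mul_eq_zero_of_le hp2 hS he k a (hlt hij).2.1.le (hS j hj a haj.symm)
        (hS i hi k hki.symm), smul_zero]
      exact fun h => hbad ⟨hki.symm.trans (h.1.symm.trans haj),
        (even_iff_of_modEq hp2 (h.1.trans hki)).mp h.2⟩

end Vanishing

section Spanning

variable {e : ℕ → A} {S : Set ℕ}

/-- The span of the admissible monomials of length `n` with indices in `S`. -/
def admissibleSpan (p : ℕ) {A : Type*} [Ring A] [Algebra (ZMod p) A] (e : ℕ → A) (S : Set ℕ)
    (n : ℕ) : Submodule (ZMod p) A :=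
  Submodule.span (ZMod p)
    {x | ∃ w : List ℕ, EvenCongruentAdmissible p w ∧ (∀ a ∈ w, a ∈ S) ∧ w.length = n ∧
      monomial e w = x}

theorem monomial_cons {B : Type*} [Monoid B] (e : ℕ → B) (a : ℕ) (w : List ℕ) :
    monomial e (a :: w) = e a * monomial e w := rfl

/-- Rewriting an inadmissible product `e_i e_j` by its Adem relation only produces products
`e_a e_k` with `a < i`, so that an induction on the first index applies. -/
theorem monomial_mem_admissibleSpan (hp2 : p ≠ 2) (hSe : ∀ a ∈ S, Even a)
    (hS : ∀ a ∈ S, ∀ b, a ≡ b [MOD p - 1] → b ∈ S)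
    (he : ∀ i ∈ S, ∀ j ∈ S, e i * e j = ademRHS p e i j) (n : ℕ) :
    ∀ w : List ℕ, w.length = n → (∀ a ∈ w, a ∈ S) →
      monomial e w ∈ admissibleSpan p e S n := by
  have hp : p.Prime := Fact.out
  induction n with
  | zero =>
    intro w hw _
    rw [List.length_eq_zero_iff] at hw
    subst hw
    exact Submodule.subset_span ⟨[], ⟨by simp, List.isChain_nil, List.isChain_nil⟩, by simp, rfl,
      rfl⟩
  | succ n ihn =>
    have key : ∀ i ∈ S, ∀ x ∈ admissibleSpan p e S n, e i * x ∈ admissibleSpan p e S (n + 1) := by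
      intro i
      induction i using Nat.strong_induction_on with
      | _ i ih =>
      intro hi x hx
      induction hx using Submodule.span_induction with
      | zero => rw [mul_zero]; exact Submodule.zero_mem _
      | add x y _ _ hx hy => rw [mul_add]; exact Submodule.add_mem _ hx hy
      | smul c x _ hx => rw [mul_smul_comm]; exact Submodule.smul_mem _ _ hx
      | mem x hx =>
        obtain ⟨w, hw, hwS, hlen, rfl⟩ := hx
        rw [← monomial_cons]
        cases w with
        | nil =>
          refine Submodule.subset_span ⟨[i], ⟨?_, List.isChain_singleton _,
            List.isChain_singleton _⟩, ?_, by simpa [eq_comm] using hlen, rfl⟩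
          · simpa using hSe i hi
          · simpa using hi
        | cons j w =>
          have hj : j ∈ S := hwS j List.mem_cons_self
          by_cases hgood : i ≡ j [MOD p - 1] ∧ Even i
          swap
          · rw [monomial_cons, monomial_cons, ← mul_assoc,
              mul_eq_zero_of_not_modEq_or_odd hp2 hS he hi hj hgood, zero_mul]
            exact Submodule.zero_mem _
          rcases le_or_gt i j with hij | hij
          · refine Submodule.subset_span ⟨i :: j :: w, ⟨?_, ?_, ?_⟩, ?_, by simpa using hlen, rfl⟩
            · exact List.forall_mem_cons.mpr ⟨hgood.2, hw.1⟩
            · exact List.isChain_cons_cons.mpr ⟨hij, hw.2.1⟩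
            · exact List.isChain_cons_cons.mpr ⟨hgood.1, hw.2.2⟩
            · exact List.forall_mem_cons.mpr ⟨hi, hwS⟩
          · rw [monomial_cons, monomial_cons, ← mul_assoc, he i hi j hj, ademRHS, Finset.sum_mul]
            refine Submodule.sum_mem _ fun k _ => ?_
            rcases ademTerm_eq_zero_or hp.two_le e i j k with h0 | ⟨c, a, h0, hki, haj, hlt, -⟩
            · rw [h0, zero_mul]
              exact Submodule.zero_mem _
            · have hai := (hlt hij).2.1.trans (hlt hij).2.2
              rw [h0, smul_mul_assoc, mul_assoc, ← monomial_cons]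
              refine Submodule.smul_mem _ _ (ih a hai (hS j hj a haj.symm) _ ?_)
              refine ihn _ (by simpa using hlen) (List.forall_mem_cons.mpr
                ⟨hS i hi k hki.symm, fun b hb => hwS b (List.mem_cons_of_mem _ hb)⟩)
    intro w hlen hwS
    cases w with
    | nil => simp at hlen
    | cons i w =>
      exact key i (hwS i List.mem_cons_self) _
        (ihn w (by simpa using hlen) fun b hb => hwS b (List.mem_cons_of_mem _ hb))

theorem monomial_eq_zero_of_mem_odd (hp2 : p ≠ 2) (he : ∀ i j, e i * e j = ademRHS p e i j)
    (w : List ℕ) (hlen : 1 < w.length) (hodd : ∃ a ∈ w, ¬ Even a) : monomial e w = 0 := by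
  induction w with
  | nil => simp at hlen
  | cons i w ih =>
    cases w with
    | nil => simp at hlen
    | cons j w =>
      by_cases hgood : i ≡ j [MOD p - 1] ∧ Even i
      · have hj : Even j := (even_iff_of_modEq hp2 hgood.1).mp hgood.2
        obtain ⟨a, ha, hae⟩ := hodd
        have ha' : a ∈ j :: w := (List.mem_cons.mp ha).resolve_left fun h => hae (h ▸ hgood.2)
        have hw : a ∈ w := (List.mem_cons.mp ha').resolve_left fun h => hae (h ▸ hj)
        rw [monomial_cons, ih ?_ ⟨a, ha', hae⟩, mul_zero]
        have := List.length_pos_of_mem hw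
        simpa using this
      · rw [monomial_cons, monomial_cons, ← mul_assoc,
          mul_eq_zero_of_not_modEq_or_odd (S := Set.univ) hp2 (fun _ _ _ _ => Set.mem_univ _)
            (fun i _ j _ => he i j) (Set.mem_univ i) (Set.mem_univ j) hgood, zero_mul]

end Spanning

end

/-! ### The bases -/

section

variable {p : ℕ} {A : Type*} [Ring A] [Algebra (ZMod p) A]

theorem map_monomial {B : Type*} [Ring B] [Algebra (ZMod p) B] (f : A →ₐ[ZMod p] B) (e : ℕ → A)
    (w : List ℕ) : f (monomial e w) = monomial (fun i => f (e i)) w := by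
  rw [monomial, map_list_prod, List.map_map]
  rfl

theorem map_ademRHS {B : Type*} [Ring B] [Algebra (ZMod p) B] (f : A →ₐ[ZMod p] B) (e : ℕ → A)
    (i j : ℕ) : f (ademRHS p e i j) = ademRHS p (fun i => f (e i)) i j :=
  map_ademRHS_of_map_mul f.toLinearMap e _ (fun a b => map_mul f (e a) (e b)) i j

/-- The Adem relations hold in the quotient by the Adem relations. -/
theorem mkAlgHom_adem (e : ℕ → A) (S : Set ℕ) {i j : ℕ} (hi : i ∈ S) (hj : j ∈ S) :
    RingQuot.mkAlgHom (ZMod p) (AdemRel p e S) (e i) *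
        RingQuot.mkAlgHom (ZMod p) (AdemRel p e S) (e j) =
      ademRHS p (fun i => RingQuot.mkAlgHom (ZMod p) (AdemRel p e S) (e i)) i j := by
  rw [← map_mul, ← map_ademRHS]
  exact RingQuot.mkAlgHom_rel (ZMod p) ⟨i, hi, j, hj, rfl, rfl⟩

/-- An algebra homomorphism out of a quotient by Adem relations. -/
theorem exists_algHom_ademQuotient {B : Type*} [Ring B] [Algebra (ZMod p) B] (e : ℕ → A)
    (S : Set ℕ) (f : A →ₐ[ZMod p] B)
    (h : ∀ i ∈ S, ∀ j ∈ S, f (e i) * f (e j) = ademRHS p (fun i => f (e i)) i j) :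
    ∃ g : RingQuot (AdemRel p e S) →ₐ[ZMod p] B,
      ∀ x, g (RingQuot.mkAlgHom (ZMod p) (AdemRel p e S) x) = f x := by
  refine ⟨RingQuot.liftAlgHom (ZMod p) ⟨f, ?_⟩, fun x => RingQuot.liftAlgHom_mkAlgHom_apply _ _ _ _⟩
  rintro _ _ ⟨i, hi, j, hj, rfl, rfl⟩
  rw [map_mul, h i hi j hj, map_ademRHS]

/-- An algebra homomorphism out of a quotient of `Û` by some of its generators. -/
theorem exists_algHom_killQuotient {B : Type*} [Ring B] [Algebra (ZMod p) B] (S : Set ℕ)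
    (b : ℕ → B) (h : ∀ i, i ∉ S → b i = 0) :
    ∃ g : RingQuot (KillRel p S) →ₐ[ZMod p] B,
      ∀ i, g (RingQuot.mkAlgHom (ZMod p) (KillRel p S) (eUHat p i)) = b i := by
  refine ⟨RingQuot.liftAlgHom (ZMod p) ⟨FreeAlgebra.lift (ZMod p) b, ?_⟩, fun i => ?_⟩
  · rintro _ _ ⟨i, hi, rfl, rfl⟩
    rw [map_zero, eUHat, FreeAlgebra.lift_ι_apply, h i hi]
  · rw [RingQuot.liftAlgHom_mkAlgHom_apply, eUHat, FreeAlgebra.lift_ι_apply]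

theorem mkAlgHom_kill (S : Set ℕ) {i : ℕ} (hi : i ∉ S) :
    RingQuot.mkAlgHom (ZMod p) (KillRel p S) (eUHat p i) = 0 := by
  rw [← map_zero (RingQuot.mkAlgHom (ZMod p) (KillRel p S))]
  exact RingQuot.mkAlgHom_rel (ZMod p) ⟨i, hi, rfl, rfl⟩

theorem span_monomial_eq_top (f : UHat p →ₐ[ZMod p] A) (hf : Function.Surjective f) :
    Submodule.span (ZMod p) (Set.range (monomial fun i => f (eUHat p i))) = ⊤ := by
  rw [eq_top_iff]
  rintro x -
  obtain ⟨y, rfl⟩ := hf x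
  have hy : y ∈ Algebra.adjoin (ZMod p) (Set.range (FreeAlgebra.ι (ZMod p) (X := ℕ))) := by
    rw [FreeAlgebra.adjoin_range_ι]
    trivial
  rw [← Subalgebra.mem_toSubmodule, Algebra.adjoin_eq_span] at hy
  induction hy using Submodule.span_induction with
  | mem y hy =>
    refine Submodule.subset_span ?_
    induction hy using Submonoid.closure_induction with
    | mem y hy =>
      obtain ⟨i, rfl⟩ := hy
      exact ⟨[i], by simp [monomial, eUHat]⟩
    | one => exact ⟨[], by simp [monomial]⟩
    | mul y z _ _ hy hz =>
      obtain ⟨v, hv⟩ := hy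
      obtain ⟨w, hw⟩ := hz
      exact ⟨v ++ w, by rw [map_mul, ← hv, ← hw, monomial, List.map_append, List.prod_append]; rfl⟩
  | zero => rw [map_zero]; exact Submodule.zero_mem _
  | add y z _ _ hy hz => rw [map_add]; exact Submodule.add_mem _ hy hz
  | smul c y _ hy => rw [map_smul]; exact Submodule.smul_mem _ _ hy

theorem monomial_eq_zero_of_mem {e : ℕ → A} {w : List ℕ} {a : ℕ} (ha : a ∈ w) (h : e a = 0) :
    monomial e w = 0 :=
  List.prod_eq_zero (List.mem_map.mpr ⟨a, ha, h⟩)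

/-- Independence of admissible monomials is detected in `OpAlgebra`. -/
theorem linearIndependent_monomial_of_algHom [Fact p.Prime] {e : ℕ → A}
    (f : A →ₐ[ZMod p] OpAlgebra p) {ι : Type*} (word : ι → List ℕ)
    (hinj : Function.Injective word) (hw : ∀ x, EvenCongruentAdmissible p (word x))
    (hf : ∀ x, ∀ a ∈ word x, f (e a) = gradedOp p a) :
    LinearIndependent (ZMod p) fun x => monomial e (word x) := by
  refine LinearIndependent.of_comp f.toLinearMap ?_
  have h := (linearIndependent_monomial_gradedOp p).comp
    (fun x => (⟨word x, hw x⟩ : {w : List ℕ // EvenCongruentAdmissible p w}))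
    (fun x y hxy => hinj (congrArg Subtype.val hxy))
  convert h using 1
  funext x
  change f (monomial e (word x)) = monomial (gradedOp p) (word x)
  rw [map_monomial]
  exact congrArg List.prod (List.map_congr_left fun a ha => hf x a ha)

theorem exists_basis_of_eq_span {ι : Type*} {v : ι → A} (hv : LinearIndependent (ZMod p) v)
    {N : Submodule (ZMod p) A} (hN : N = Submodule.span (ZMod p) (Set.range v)) :
    ∃ b : Module.Basis ι (ZMod p) N, ∀ x, (b x : A) = v x := by
  subst hN
  exact ⟨Module.Basis.span hv, fun x => congrArg Subtype.val (Module.Basis.span_apply hv x)⟩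

theorem gradedOp_eq_zero_of_odd {i : ℕ} (hi : ¬ Even i) : gradedOp p i = 0 := by
  rw [gradedOp, residueOp_eq_zero_of_odd hi]
  exact Polynomial.monomial_zero_right 1

theorem eKHat_mul_eKHat (p i j : ℕ) : eKHat p i * eKHat p j = ademRHS p (eKHat p) i j :=
  mkAlgHom_adem (eUHat p) Set.univ (Set.mem_univ i) (Set.mem_univ j)

end

section

variable (p : ℕ) [Fact p.Prime]

theorem exists_basis_KTilde (hp2 : p ≠ 2) :
    ∃ b : Module.Basis {w : List ℕ // EvenCongruentAdmissible p w} (ZMod p) (KTilde p),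
      ∀ w, b w = monomial (eKTilde p) w.1 := by
  have he : ∀ i ∈ {i | Even i}, ∀ j ∈ {i | Even i},
      eKTilde p i * eKTilde p j = ademRHS p (eKTilde p) i j :=
    fun i hi j hj => mkAlgHom_adem (eUTilde p) {i | Even i} hi hj
  have hli : LinearIndependent (ZMod p)
      fun w : {w : List ℕ // EvenCongruentAdmissible p w} => monomial (eKTilde p) w.1 := by
    obtain ⟨f, hf⟩ := exists_algHom_killQuotient (p := p) {i | Even i} (gradedOp p)
      fun i hi => gradedOp_eq_zero_of_odd hi
    obtain ⟨g, hg⟩ := exists_algHom_ademQuotient (eUTilde p) {i | Even i} f fun i _ j _ => by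
      simp only [eUTilde, hf]
      exact gradedOp_mul_gradedOp p hp2 i j
    exact linearIndependent_monomial_of_algHom g _ Subtype.val_injective (fun w => w.2)
      fun _ a _ => (hg _).trans (hf a)
  have hspan : ⊤ ≤ Submodule.span (ZMod p) (Set.range
      fun w : {w : List ℕ // EvenCongruentAdmissible p w} => monomial (eKTilde p) w.1) := by
    have htop := span_monomial_eq_top (p := p) (A := KTilde p)
      ((RingQuot.mkAlgHom (ZMod p) (AdemRel p (eUTilde p) {i | Even i})).comp
        (RingQuot.mkAlgHom (ZMod p) (KillRel p {i | Even i})))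
      (by
        rw [AlgHom.coe_comp]
        exact (RingQuot.mkAlgHom_surjective _ _).comp (RingQuot.mkAlgHom_surjective _ _))
    rw [← htop, Submodule.span_le]
    rintro _ ⟨w, rfl⟩
    change monomial (eKTilde p) w ∈ _
    by_cases hw : ∀ a ∈ w, Even a
    · have h := monomial_mem_admissibleSpan (A := KTilde p) (e := eKTilde p) hp2
        (S := {i | Even i}) (fun _ h => h)
        (fun a ha b hab => (even_iff_of_modEq hp2 hab).mp ha) he w.length w rfl hw
      refine Submodule.span_mono ?_ h
      rintro _ ⟨v, hv, -, -, rfl⟩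
      exact ⟨⟨v, hv⟩, rfl⟩
    · push Not at hw
      obtain ⟨a, ha, hodd⟩ := hw
      have h0 : eKTilde p a = 0 := by
        rw [eKTilde, eUTilde, mkAlgHom_kill _ (by simpa using hodd), map_zero]
      have h1 : monomial (eKTilde p) w = 0 := monomial_eq_zero_of_mem (A := KTilde p) ha h0
      rw [h1]
      exact Submodule.zero_mem _
  exact ⟨Module.Basis.mk hli hspan, fun w => Module.Basis.mk_apply hli hspan w⟩

theorem linearIndependent_monomial_eKHat (hp2 : p ≠ 2) :
    LinearIndependent (ZMod p) fun w : {w : List ℕ // EvenCongruentAdmissible p w} =>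
      monomial (eKHat p) w.1 := by
  have hf : ∀ i, FreeAlgebra.lift (ZMod p) (gradedOp p) (eUHat p i) = gradedOp p i :=
    fun i => FreeAlgebra.lift_ι_apply _ _
  obtain ⟨g, hg⟩ := exists_algHom_ademQuotient (eUHat p) Set.univ
    (FreeAlgebra.lift (ZMod p) (gradedOp p)) fun i _ j _ => by
      simp only [hf]
      exact gradedOp_mul_gradedOp p hp2 i j
  exact linearIndependent_monomial_of_algHom g _ Subtype.val_injective (fun w => w.2)
    fun _ a _ => (hg _).trans (hf a)

theorem lengthPart_eKHat_eq_span (hp2 : p ≠ 2) {n : ℕ} (hn : 1 < n) :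
    lengthPart p (eKHat p) n = Submodule.span (ZMod p) (Set.range
      fun w : {w : List ℕ // EvenCongruentAdmissible p w ∧ w.length = n} =>
        monomial (eKHat p) w.1) := by
  apply le_antisymm
  · refine Submodule.span_le.mpr ?_
    rintro _ ⟨w, hlen, rfl⟩
    by_cases hw : ∀ a ∈ w, Even a
    · have h := monomial_mem_admissibleSpan hp2 (S := {i | Even i}) (fun _ h => h)
        (fun a ha b hab => (even_iff_of_modEq hp2 hab).mp ha)
        (fun i _ j _ => eKHat_mul_eKHat p i j) n w hlen hw
      refine Submodule.span_mono ?_ h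
      rintro _ ⟨v, hv, -, hvn, rfl⟩
      exact ⟨⟨v, hv, hvn⟩, rfl⟩
    · push Not at hw
      rw [monomial_eq_zero_of_mem_odd hp2 (eKHat_mul_eKHat p) w (hlen ▸ hn)]
      · exact Submodule.zero_mem _
      · simpa using hw
  · refine Submodule.span_mono ?_
    rintro _ ⟨w, rfl⟩
    exact ⟨w.1, w.2.2, rfl⟩

theorem exists_basis_lengthPart_KHat (hp2 : p ≠ 2) {n : ℕ} (hn : 1 < n) :
    ∃ b : Module.Basis {w : List ℕ // EvenCongruentAdmissible p w ∧ w.length = n} (ZMod p)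
        (lengthPart p (eKHat p) n), ∀ w, (b w : KHat p) = monomial (eKHat p) w.1 :=
  exists_basis_of_eq_span
    ((linearIndependent_monomial_eKHat p hp2).comp
      (fun w : {w : List ℕ // EvenCongruentAdmissible p w ∧ w.length = n} => ⟨w.1, w.2.1⟩)
      fun _ _ h => Subtype.ext (Subtype.mk.inj h))
    (lengthPart_eKHat_eq_span p hp2 hn)

theorem exists_basis_lengthGTOne_KHat (hp2 : p ≠ 2) :
    ∃ b : Module.Basis {w : List ℕ // EvenCongruentAdmissible p w ∧ 1 < w.length} (ZMod p)
        (lengthGTOne p (eKHat p)), ∀ w, (b w : KHat p) = monomial (eKHat p) w.1 := by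
  refine exists_basis_of_eq_span
    ((linearIndependent_monomial_eKHat p hp2).comp
      (fun w : {w : List ℕ // EvenCongruentAdmissible p w ∧ 1 < w.length} => ⟨w.1, w.2.1⟩)
      fun _ _ h => Subtype.ext (Subtype.mk.inj h)) ?_
  apply le_antisymm
  · refine iSup_le fun n => ?_
    rw [lengthPart_eKHat_eq_span p hp2 n.2]
    refine Submodule.span_mono ?_
    rintro _ ⟨w, rfl⟩
    exact ⟨⟨w.1, w.2.1, by rw [w.2.2]; exact n.2⟩, rfl⟩
  · refine Submodule.span_le.mpr ?_
    rintro _ ⟨w, rfl⟩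
    exact Submodule.mem_iSup_of_mem (⟨w.1.length, w.2.2⟩ : {n : ℕ // 1 < n})
      (Submodule.subset_span ⟨w.1, rfl, rfl⟩)

theorem exists_basis_KEven (hp2 : p ≠ 2) :
    ∃ b : Module.Basis {w : List ℕ // Admissible w} (ZMod p) (KEven p),
      ∀ w, b w = monomial (dKEven p) w.1 := by
  have hp : p.Prime := Fact.out
  have heven : Even (p - 1) := hp.even_sub_one hp2
  have hp1 : 0 < p - 1 := Nat.sub_pos_of_lt hp.one_lt
  set S : Set ℕ := {i | (p - 1) ∣ i} with hS
  have hSe : ∀ a ∈ S, Even a := fun a ha => even_iff_two_dvd.mpr (heven.two_dvd.trans ha)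
  have hSmod : ∀ a ∈ S, ∀ b, a ≡ b [MOD p - 1] → b ∈ S :=
    fun a ha b hab => (hab.dvd_iff dvd_rfl).mp ha
  let e : ℕ → KEven p := fun i => RingQuot.mkAlgHom (ZMod p) (AdemRel p (eUEven p) S) (eUEven p i)
  have he : ∀ i ∈ S, ∀ j ∈ S, e i * e j = ademRHS p e i j :=
    fun i hi j hj => mkAlgHom_adem (eUEven p) S hi hj
  have hd : ∀ w : List ℕ, monomial (dKEven p) w = monomial e (w.map (· * (p - 1))) := by
    intro w
    rw [monomial, monomial, List.map_map]
    rfl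
  have hadm : ∀ w : List ℕ, Admissible w → EvenCongruentAdmissible p (w.map (· * (p - 1))) := by
    intro w hw
    refine ⟨?_, ?_, ?_⟩
    · intro a ha
      obtain ⟨b, -, rfl⟩ := List.mem_map.mp ha
      exact heven.mul_left b
    · exact (List.isChain_map _).mpr (hw.imp fun _ _ h => Nat.mul_le_mul_right _ h)
    · refine (List.isChain_map _).mpr (hw.imp fun a b _ => ?_)
      exact ((Nat.modEq_zero_iff_dvd.mpr (Nat.dvd_mul_left _ a))).trans
        (Nat.modEq_zero_iff_dvd.mpr (Nat.dvd_mul_left _ b)).symm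
  have hli : LinearIndependent (ZMod p)
      fun w : {w : List ℕ // Admissible w} => monomial (dKEven p) w.1 := by
    classical
    let b : ℕ → OpAlgebra p := fun i => if i ∈ S then gradedOp p i else 0
    obtain ⟨f, hf⟩ := exists_algHom_killQuotient (p := p) S b fun i hi => if_neg hi
    obtain ⟨g, hg⟩ := exists_algHom_ademQuotient (eUEven p) S f fun i hi j hj => by
      simp only [eUEven]
      rw [hf, hf, show b i = gradedOp p i from if_pos hi, show b j = gradedOp p j from if_pos hj,
        gradedOp_mul_gradedOp p hp2]
      refine ademRHS_congr hp.two_le fun k l hk hl => ?_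
      rw [hf, hf, show b k = gradedOp p k from if_pos (hSmod j hj k hk.symm),
        show b l = gradedOp p l from if_pos (hSmod i hi l hl.symm)]
    simp_rw [hd]
    refine linearIndependent_monomial_of_algHom g
      (fun w : {w : List ℕ // Admissible w} => w.1.map (· * (p - 1)))
      (fun v w h => Subtype.ext (List.map_injective_iff.mpr
        (fun a b hab => Nat.eq_of_mul_eq_mul_right hp1 hab) h)) (fun w => hadm w.1 w.2) ?_
    intro w a ha
    obtain ⟨m, -, rfl⟩ := List.mem_map.mp ha
    exact (hg _).trans ((hf _).trans (if_pos (Nat.dvd_mul_left _ m)))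
  have hspan : ⊤ ≤ Submodule.span (ZMod p) (Set.range
      fun w : {w : List ℕ // Admissible w} => monomial (dKEven p) w.1) := by
    have htop := span_monomial_eq_top (p := p) (A := KEven p)
      ((RingQuot.mkAlgHom (ZMod p) (AdemRel p (eUEven p) S)).comp
        (RingQuot.mkAlgHom (ZMod p) (KillRel p S)))
      (by
        rw [AlgHom.coe_comp]
        exact (RingQuot.mkAlgHom_surjective _ _).comp (RingQuot.mkAlgHom_surjective _ _))
    rw [← htop, Submodule.span_le]
    rintro _ ⟨w, rfl⟩
    change monomial e w ∈ _
    by_cases hw : ∀ a ∈ w, a ∈ S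
    · have h := monomial_mem_admissibleSpan (A := KEven p) (e := e) hp2 hSe hSmod he
        w.length w rfl hw
      refine Submodule.span_mono ?_ h
      rintro _ ⟨v, hv, hvS, -, rfl⟩
      refine ⟨⟨v.map (· / (p - 1)), (List.isChain_map _).mpr
        (hv.2.1.imp fun _ _ h => Nat.div_le_div_right h)⟩, ?_⟩
      dsimp only
      rw [hd, List.map_map]
      congr 1
      exact (List.map_congr_left (g := fun a => a) fun a ha =>
        Nat.div_mul_cancel (hvS a ha)).trans (List.map_id' v)
    · push Not at hw
      obtain ⟨a, ha, haS⟩ := hw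
      have h0 : e a = 0 := by
        change RingQuot.mkAlgHom (ZMod p) _ (eUEven p a) = 0
        rw [eUEven, mkAlgHom_kill _ haS, map_zero]
      have h1 : monomial e w = 0 := monomial_eq_zero_of_mem (A := KEven p) ha h0
      rw [h1]
      exact Submodule.zero_mem _
  exact ⟨Module.Basis.mk hli hspan, fun w => Module.Basis.mk_apply hli hspan w⟩

end

end KudoArakiMay

end

theorem theorem1p13 (p : ℕ) [Fact p.Prime] (hp2 : p ≠ 2) :
    (∃ b : Module.Basis {w : List ℕ // KudoArakiMay.EvenCongruentAdmissible p w} (ZMod p)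
        (KudoArakiMay.KTilde p),
      ∀ w, b w = KudoArakiMay.monomial (KudoArakiMay.eKTilde p) w.1) ∧
    ((∃ b : Module.Basis
          {w : List ℕ // KudoArakiMay.EvenCongruentAdmissible p w ∧ 1 < w.length} (ZMod p)
          (KudoArakiMay.lengthGTOne p (KudoArakiMay.eKHat p)),
        ∀ w, (b w : KudoArakiMay.KHat p) =
          KudoArakiMay.monomial (KudoArakiMay.eKHat p) w.1) ∧
      ∀ n : ℕ, 1 < n →
        ∃ b : Module.Basis
            {w : List ℕ // KudoArakiMay.EvenCongruentAdmissible p w ∧ w.length = n} (ZMod p)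
            (KudoArakiMay.lengthPart p (KudoArakiMay.eKHat p) n),
          ∀ w, (b w : KudoArakiMay.KHat p) =
            KudoArakiMay.monomial (KudoArakiMay.eKHat p) w.1) ∧
    (∃ b : Module.Basis {w : List ℕ // KudoArakiMay.Admissible w} (ZMod p)
        (KudoArakiMay.KEven p),
      ∀ w, b w = KudoArakiMay.monomial (KudoArakiMay.dKEven p) w.1) :=
  ⟨KudoArakiMay.exists_basis_KTilde p hp2, ⟨KudoArakiMay.exists_basis_lengthGTOne_KHat p hp2,
    fun _ hn => KudoArakiMay.exists_basis_lengthPart_KHat p hp2 hn⟩,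
    KudoArakiMay.exists_basis_KEven p hp2⟩
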